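/- Let $\omega$ be the Fubini–Study form on $\mathbb{CP}^n$, with potential $\frac12\log(1+|w|^2)$ in each affine chart $\mathbb{C}^n$. Let $PSH(\mathbb{CP}^n,\omega)$ be the set of upper semicontinuous functions $\varphi:\mathbb{CP}^n\to[-\infty,\infty)$, not identically $-\infty$, such that $\omega+dd^c\varphi\ge 0$, in the sense that $\varphi+\frac12\log(1+|w|^2)$ is plurisubharmonic in each affine chart. For $K\subset\mathbb{CP}^n$ put $$V_{K,\omega}(x)=\sup\{\varphi(x) : \varphi\in PSH(\mathbb{CP}^n,\omega),\ \varphi\le 0 \text{ on } K\},\qquad T_\omega(K)=\exp\Big(-\sup_{\mathbb{CP}^n}V_{K,\omega}^*\Big),$$ where $V^*$ denotes the upper semicontinuous regularization of $V$ and $\exp(-\infty)=0$. Let $f:\mathbb{CP}^n\to\mathbb{CP}^n$ be a holomorphic endomorphism of algebraic degree $\lambda\ge 2$, i.e. $f=[F_0:\dots:F_n]$ with homogeneous polynomials $F_i$ of degree $\lambda$ that have no common zero other than the origin. Then there is $0<\alpha<1$, depending only on $f$, such that for all Borel sets $K\subset\mathbb{CP}^n$ and all integers $j\ge 0$, $$\left[\alpha\,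 T_\omega(K)\right]^{\lambda^j}\le T_\omega(f^j(K)),$$ where $f^j$ is the $j$-th iterate of $f$. -/

import Mathlib

open scoped LinearAlgebra.Projectivization

noncomputable section

/-- Complex projective space `ℂℙⁿ`: the lines of `ℂⁿ⁺¹` through the origin. -/
abbrev CP (n : ℕ) : Type := ℙ ℂ (Fin (n + 1) → ℂ)

/-- `ℂℙⁿ` carries the quotient topology of `ℂⁿ⁺¹ \ {0}`. -/
instance instTopologicalSpaceCP (n : ℕ) : TopologicalSpace (CP n) :=
  TopologicalSpace.coinduced
    (Projectivization.mk' ℂ : {v : Fin (n + 1) → ℂ // v ≠ 0} → CP n) inferInstance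

namespace CP

/-- The `i`-th affine chart domain `{z_i ≠ 0}`. -/
def affineOpen {n : ℕ} (i : Fin (n + 1)) : Set (CP n) := {p | p.rep i ≠ 0}

/-- The affine coordinates `(z_k / z_i)_{k ≠ i}` on `{z_i ≠ 0}`. -/
def affineCoord {n : ℕ} (i : Fin (n + 1)) (p : CP n) : Fin n → ℂ :=
  fun k => p.rep (i.succAbove k) / p.rep i

lemma insertNth_one_ne_zero {n : ℕ} (i : Fin (n + 1)) (w : Fin n → ℂ) :
    (i.insertNth (α := fun _ => ℂ) 1 w : Fin (n + 1) → ℂ) ≠ 0 := by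
  intro h
  have := congrFun h i
  simp at this

/-- The inverse of the `i`-th affine chart, `ℂⁿ → {z_i ≠ 0}`, putting a `1` in position `i`. -/
def affineEmb {n : ℕ} (i : Fin (n + 1)) (w : Fin n → ℂ) : CP n :=
  Projectivization.mk ℂ (i.insertNth (α := fun _ => ℂ) 1 w : Fin (n + 1) → ℂ)
    (insertNth_one_ne_zero i w)

/-- Holomorphic self-maps of `ℂℙⁿ`: continuous, and complex differentiable when read in the
affine charts. -/
def IsHolomorphic {n : ℕ} (f : CP n → CP n) : Prop :=
  Continuous f ∧ ∀ i j : Fin (n + 1),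
    DifferentiableOn ℂ (fun w : Fin n → ℂ => affineCoord j (f (affineEmb i w)))
      {w | f (affineEmb i w) ∈ affineOpen j}

/-- `f = [F₀ : ⋯ : Fₙ]` with homogeneous polynomials `Fᵢ` of degree `d` whose only common zero is
the origin. -/
def IsGivenByDegree {n : ℕ} (f : CP n → CP n) (d : ℕ) : Prop :=
  ∃ F : Fin (n + 1) → MvPolynomial (Fin (n + 1)) ℂ,
    (∀ i, (F i).IsHomogeneous d) ∧
    ∃ hF : ∀ z : Fin (n + 1) → ℂ, z ≠ 0 → (fun i => MvPolynomial.eval z (F i)) ≠ 0,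
      ∀ (z : Fin (n + 1) → ℂ) (hz : z ≠ 0),
        f (Projectivization.mk ℂ z hz) =
          Projectivization.mk ℂ (fun i => MvPolynomial.eval z (F i)) (hF z hz)

/-- The algebraic degree of a holomorphic self-map of `ℂℙⁿ`: the degree of the homogeneous
polynomials without common zeros which define it (for `n ≥ 1` there is exactly one such degree). -/
def algebraicDegree {n : ℕ} (f : CP n → CP n) : ℕ := sInf {d | IsGivenByDegree f d}

/-- The mean of an extended-real function over the circle `θ ↦ a + e^{iθ} b`: mean of the positive
part minus mean of the negative part. For a function bounded above the first is finite, so that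
the value is the integral in `[-∞, ∞)`. -/
def circleMean {m : ℕ} (u : (Fin m → ℂ) → EReal) (a b : Fin m → ℂ) : EReal :=
  ((MeasureTheory.laverage (MeasureTheory.volume.restrict (Set.Ioc (0 : ℝ) (2 * Real.pi)))
      fun θ : ℝ => (u (a + Complex.exp (θ * Complex.I) • b)).toENNReal : ENNReal) : EReal) -
  ((MeasureTheory.laverage (MeasureTheory.volume.restrict (Set.Ioc (0 : ℝ) (2 * Real.pi)))
      fun θ : ℝ => (-u (a + Complex.exp (θ * Complex.I) • b)).toENNReal : ENNReal) : EReal)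

/-- Plurisubharmonic functions `ℂᵐ → [-∞, ∞)` (here `-∞` is allowed as a constant): upper
semicontinuous, with the sub-mean value inequality on all circles in complex lines. -/
structure IsPsh {m : ℕ} (u : (Fin m → ℂ) → EReal) : Prop where
  lt_top : ∀ a, u a < ⊤
  usc : UpperSemicontinuous u
  submean : ∀ a b, u a ≤ circleMean u a b

/-- The potential `½ log (1 + |w|²)` of the Fubini–Study form `ω` in each affine chart. -/
def fsPotential {n : ℕ} (w : Fin n → ℂ) : ℝ := Real.log (1 + ∑ k, ‖w k‖ ^ 2) / 2

/-- `PSH(ℂℙⁿ, ω)` for the Fubini–Study form `ω`: upper semicontinuous functions with values in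
`[-∞, ∞)`, not identically `-∞`, with `ω + dd^c φ ≥ 0`, that is, such that `φ` plus the local
potential of `ω` is plurisubharmonic in each affine chart `ℂⁿ`. (Such a function is integrable,
as `ℂℙⁿ` is connected.) -/
structure IsOmegaPsh {n : ℕ} (φ : CP n → EReal) : Prop where
  usc : UpperSemicontinuous φ
  ne_bot : ∃ p, φ p ≠ ⊥
  psh : ∀ i : Fin (n + 1), IsPsh fun w : Fin n → ℂ => φ (affineEmb i w) + (fsPotential w : EReal)

/-- The global extremal function `V_{K,ω}`. -/
def extremal {n : ℕ} (K : Set (CP n)) (p : CP n) : EReal :=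
  sSup {t | ∃ φ : CP n → EReal, IsOmegaPsh φ ∧ (∀ q ∈ K, φ q ≤ 0) ∧ t = φ p}

/-- The upper semicontinuous regularization `V_{K,ω}^*`; the neighbourhoods of `p` contain `p`. -/
def extremalReg {n : ℕ} (K : Set (CP n)) (p : CP n) : EReal :=
  Filter.limsup (extremal K) (nhds p)

/-- The Alexander capacity `T_ω(K) = exp (- sup V_{K,ω}^*)`, with `exp (-∞) = 0`. -/
def alexanderCapacity {n : ℕ} (K : Set (CP n)) : ENNReal :=
  EReal.exp (-(⨆ p, extremalReg K p))

end CP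

end

/-! Write `d` for the degree and `F` for the homogeneous lift of `f`. The function `g = d⁻¹
log|F(z)| - log|z|` is invariant under scaling, so it descends to projective space and is bounded by
compactness. If `φ` is `ω`-psh, so is `d⁻¹ φ ∘ f + g + e` for every constant `e`. If moreover `φ ≤
0` on `f(K)`, a suitable `e` makes this function a competitor for `K`. Since `f` is surjective, `sup
V_{f(K)} ≤ d (sup V_K + D)` with `D` independent of `K`, hence `T(f(K)) ≥ (e^{-D} T(K))^d`.
Iteration gives the theorem (`IsGivenByDegree.exists_pullback`,
`IsGivenByDegree.exists_iSup_extremal_image_le`).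

Most of the work lies in the pullback, because plurisubharmonicity is defined by sub-mean values on
affine circles only. To pass to holomorphic discs (`IsRealPsh.le_circleAverage_comp`), truncate from
below and mollify to a `C¹` function. Along a disc it satisfies the sub-mean inequality up to
`o(r²)`, because the second-order deviation of the disc from its tangent line has mean zero under
the differential. A maximum principle turns this local asymptotic inequality into the genuine one
(`AsymptoticSubmeanOn.le_circleAverage`), and the mollification is removed in the limit.

Surjectivity comes from Krull's height theorem and the Nullstellensatz
(`MvPolynomial.exists_ne_zero_forall_eval_eq_zero`). -/

section OneVariable

/-! ### Subharmonicity in one variable from an asymptotic condition. -/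

open Metric Filter Topology Real

lemma circleIntegrable_of_upperSemicontinuousOn {v : ℂ → ℝ} {a : ℂ} {R N : ℝ}
    (husc : UpperSemicontinuousOn v (sphere a |R|)) (hb : ∀ z ∈ sphere a |R|, N ≤ v z) :
    CircleIntegrable v a R := by
  have h1 : UpperSemicontinuous (fun θ : ℝ => v (circleMap a R θ)) := by
    rw [← upperSemicontinuousOn_univ_iff]
    exact husc.comp (continuous_circleMap a R).continuousOn
      (fun θ _ => circleMap_mem_sphere' a R θ)
  obtain ⟨B, hB⟩ := husc.bddAbove_of_isCompact (isCompact_sphere a |R|)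
  have h2 : ∀ θ : ℝ, ‖v (circleMap a R θ)‖ ≤ max |N| |B| := fun θ => by
    have h3 := hb _ (circleMap_mem_sphere' a R θ)
    have h4 := hB (Set.mem_image_of_mem v (circleMap_mem_sphere' a R θ))
    exact abs_le_max_abs_abs h3 h4
  rw [circleIntegrable_def, intervalIntegrable_iff]
  exact MeasureTheory.Measure.integrableOn_of_bounded (M := max |N| |B|)
    (by simpa using ENNReal.mul_ne_top ENNReal.ofNat_ne_top ENNReal.ofReal_ne_top)
    h1.measurable.aestronglyMeasurable (Eventually.of_forall h2)

/-- The real parts of entire functions are uniformly dense in the continuous functions on a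
circle. -/
lemma exists_differentiable_re_near {c : ℂ → ℝ} (hc : Continuous c) (a : ℂ) {R : ℝ} (hR : 0 < R)
    {η : ℝ} (hη : 0 < η) :
    ∃ g : ℂ → ℂ, Differentiable ℂ g ∧ ∀ z ∈ sphere a R, |c z - (g z).re| ≤ η := by
  have : Fact (0 < 2 * π) := ⟨Real.two_pi_pos⟩
  have hper : Function.Periodic (fun θ : ℝ => (c (circleMap a R θ) : ℂ)) (2 * π) := fun θ => by
    simp only [periodic_circleMap a R θ]
  let C : C(AddCircle (2 * π), ℂ) :=
    ⟨hper.lift, by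
      refine continuous_quot_lift _ ?_
      fun_prop⟩
  have hCapp : ∀ θ : ℝ, C (θ : AddCircle (2 * π)) = (c (circleMap a R θ) : ℂ) := fun θ =>
    hper.lift_coe θ
  have hmem : C ∈ (Submodule.span ℂ (Set.range (@fourier (2 * π)))).topologicalClosure := by
    rw [span_fourier_closure_eq_top]; trivial
  obtain ⟨f, hf, hfC⟩ := Metric.mem_closure_iff.1 hmem η hη
  -- On the unit circle a Fourier monomial is a power of `z` or the conjugate of one, so a
  -- trigonometric polynomial is `g + conj h`; its real part is that of `g + h`.
  have key : ∃ g h : ℂ → ℂ, Differentiable ℂ g ∧ Differentiable ℂ h ∧ ∀ θ : ℝ,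
      f (θ : AddCircle (2 * π)) = g (Complex.exp (θ * Complex.I))
        + (starRingEnd ℂ) (h (Complex.exp (θ * Complex.I))) := by
    clear hfC
    refine Submodule.span_induction (p := fun f _ => ∃ g h : ℂ → ℂ, Differentiable ℂ g ∧
      Differentiable ℂ h ∧ ∀ θ : ℝ, f (θ : AddCircle (2 * π)) = g (Complex.exp (θ * Complex.I))
        + (starRingEnd ℂ) (h (Complex.exp (θ * Complex.I)))) ?_ ?_ ?_ ?_ hf
    · rintro _ ⟨k, rfl⟩
      have hk : ∀ θ : ℝ, fourier k (θ : AddCircle (2 * π)) = Complex.exp (k * (θ * Complex.I)) := by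
        intro θ
        rw [fourier_coe_apply]
        congr 1
        push_cast
        field_simp
      rcases Int.eq_nat_or_neg k with ⟨m, rfl | rfl⟩
      · refine ⟨fun z => z ^ m, fun _ => 0, by fun_prop, by fun_prop, fun θ => ?_⟩
        simp [hk, ← Complex.exp_nat_mul]
      · refine ⟨fun _ => 0, fun z => z ^ m, by fun_prop, by fun_prop, fun θ => ?_⟩
        simp [hk, ← Complex.exp_nat_mul, ← Complex.exp_conj]
    · exact ⟨fun _ => 0, fun _ => 0, by fun_prop, by fun_prop, by simp⟩
    · rintro f₁ f₂ _ _ ⟨g₁, h₁, hg₁, hh₁, e₁⟩ ⟨g₂, h₂, hg₂, hh₂, e₂⟩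
      refine ⟨g₁ + g₂, h₁ + h₂, hg₁.add hg₂, hh₁.add hh₂, fun θ => ?_⟩
      simp only [ContinuousMap.add_apply, e₁, e₂, Pi.add_apply, map_add]
      ring
    · rintro s f₁ _ ⟨g₁, h₁, hg₁, hh₁, e₁⟩
      refine ⟨fun z => s * g₁ z, fun z => (starRingEnd ℂ) s * h₁ z, by fun_prop, by fun_prop,
        fun θ => ?_⟩
      simp only [ContinuousMap.smul_apply, e₁, smul_eq_mul, map_mul, Complex.conj_conj]
      ring
  obtain ⟨g, h, hg, hh, hgh⟩ := key
  refine ⟨fun z => g ((z - a) / R) + h ((z - a) / R), ?_, fun z hz => ?_⟩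
  · have h1 : Differentiable ℂ (fun z : ℂ => (z - a) / R) := by fun_prop
    exact (hg.comp h1).add (hh.comp h1)
  · rw [← abs_of_pos hR, ← range_circleMap] at hz
    obtain ⟨θ, rfl⟩ := hz
    have h1 : (circleMap a R θ - a) / R = Complex.exp (θ * Complex.I) := by
      have : (R : ℂ) ≠ 0 := by exact_mod_cast hR.ne'
      simp [circleMap]; field_simp
    have h2 := (ContinuousMap.dist_apply_le_dist (f := C) (g := f) (θ : AddCircle (2 * π)))
    rw [hCapp, hgh, dist_eq_norm] at h2
    have h3 := (Complex.abs_re_le_norm _).trans (h2.trans hfC.le)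
    simp only [h1]
    simpa using h3

/-- Expanding about `z`, the cross term is the real part of a holomorphic function vanishing at `z`.
The excess `r ^ 2` is the strict subharmonicity used in the maximum principle. -/
lemma circleAverage_norm_sub_sq (z a : ℂ) (r : ℝ) :
    circleAverage (fun w => ‖w - a‖ ^ 2) z r = ‖z - a‖ ^ 2 + r ^ 2 := by
  have h1 : circleAverage (fun w => ‖w - a‖ ^ 2) z r =
      circleAverage (fun w => (‖z - a‖ ^ 2 + r ^ 2)
        + (2 * (starRingEnd ℂ) (z - a) * (w - z)).re) z r := by
    refine circleAverage_congr_sphere fun w hw => ?_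
    have h2 : ‖w - z‖ ^ 2 = r ^ 2 := by
      rw [mem_sphere_iff_norm] at hw
      rw [hw, sq_abs]
    have h3 : w - a = (w - z) + (z - a) := by ring
    rw [← h2, h3, Complex.sq_norm, Complex.sq_norm, Complex.sq_norm, Complex.normSq_add]
    have : ((2 : ℂ) * (starRingEnd ℂ) (z - a) * (w - z)).re
        = 2 * ((w - z) * (starRingEnd ℂ) (z - a)).re := by
      rw [mul_assoc, mul_comm ((starRingEnd ℂ) (z - a))]
      simp
    rw [this]; ring
  have hd : Differentiable ℂ (fun w : ℂ => 2 * (starRingEnd ℂ) (z - a) * (w - z)) := by fun_prop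
  have hcont : Continuous (fun w : ℂ => 2 * (starRingEnd ℂ) (z - a) * (w - z)) := hd.continuous
  have hint : CircleIntegrable (fun w : ℂ => (2 * (starRingEnd ℂ) (z - a) * (w - z)).re) z r :=
    (Complex.continuous_re.comp hcont).continuousOn.circleIntegrable'
  rw [h1, circleAverage_fun_add (circleIntegrable_const _ _ _) hint, circleAverage_const]
  have h5 := Complex.reCLM.circleAverage_comp_comm (f := fun w : ℂ => 2 * (starRingEnd ℂ) (z - a) * (w - z))
    (c := z) (R := r) hcont.continuousOn.circleIntegrable'
  have h6 := DiffContOnCl.circleAverage (c := z) (R := r) hd.diffContOnCl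
  rw [h6] at h5
  have : (⇑Complex.reCLM ∘ fun w : ℂ => 2 * (starRingEnd ℂ) (z - a) * (w - z)) =
    fun w : ℂ => (2 * (starRingEnd ℂ) (z - a) * (w - z)).re := rfl
  rw [this] at h5
  rw [h5]; simp

lemma circleAverage_re_of_differentiable {g : ℂ → ℂ} (hg : Differentiable ℂ g) (z : ℂ) (r : ℝ) :
    circleAverage (fun w => (g w).re) z r = (g z).re := by
  have h5 := Complex.reCLM.circleAverage_comp_comm (f := g)
    (c := z) (R := r) hg.continuous.continuousOn.circleIntegrable'
  rw [DiffContOnCl.circleAverage (c := z) (R := r) hg.diffContOnCl] at h5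
  exact h5

/-- Functions with an asymptotic local sub-mean value property on a disc. -/
structure AsymptoticSubmeanOn (v : ℂ → ℝ) (a : ℂ) (R : ℝ) : Prop where
  usc : UpperSemicontinuousOn v (closedBall a R)
  bddBelow : ∃ N : ℝ, ∀ z ∈ closedBall a R, N ≤ v z
  submean : ∀ z ∈ ball a R, ∀ δ > 0, ∀ᶠ r in 𝓝[>] (0 : ℝ), v z ≤ circleAverage v z r + δ * r ^ 2

/-- Maximum principle with respect to the real part of an entire function. -/
lemma AsymptoticSubmeanOn.le_re {v : ℂ → ℝ} {a : ℂ} {R : ℝ} (hv : AsymptoticSubmeanOn v a R)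
    (hR : 0 < R) {g : ℂ → ℂ} (hg : Differentiable ℂ g) (hle : ∀ z ∈ sphere a R, v z ≤ (g z).re) :
    v a ≤ (g a).re := by
  by_contra! hlt
  obtain ⟨N, hN⟩ := hv.bddBelow
  -- The penalty `δ (R² - ‖z - a‖²)` costs half of the assumed excess at `a` and nothing on the
  -- sphere, so the penalized maximum is positive and interior.
  set δ : ℝ := (v a - (g a).re) / (2 * R ^ 2) with hδ
  have hδ0 : 0 < δ := by apply div_pos (by linarith); positivity
  have hδR : δ * R ^ 2 = (v a - (g a).re) / 2 := by rw [hδ]; field_simp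
  let k : ℂ → ℝ := fun z => -(g z).re - δ * (R ^ 2 - ‖z - a‖ ^ 2)
  have hk : Continuous k := by
    have := hg.continuous
    fun_prop
  have hw : UpperSemicontinuousOn (fun z => v z + k z) (closedBall a R) :=
    hv.usc.add hk.continuousOn.upperSemicontinuousOn
  obtain ⟨z, hz, hmax⟩ := hw.exists_isMaxOn ⟨a, mem_closedBall_self hR.le⟩ (isCompact_closedBall a R)
  have hza : 0 < v z + k z := by
    have h1 : v a + k a ≤ v z + k z := hmax (mem_closedBall_self hR.le)
    have h2 : k a = -(g a).re - δ * R ^ 2 := by simp [k]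
    rw [h2, hδR] at h1
    linarith
  have hzb : z ∈ ball a R := by
    rcases (mem_closedBall.1 hz).lt_or_eq with h | h
    · exact h
    · exfalso
      have h1 := hle z h
      have h2 : k z = -(g z).re := by
        have h3 : ‖z - a‖ = R := by rw [← dist_eq_norm]; exact h
        simp [k, h3]
      rw [h2] at hza; linarith
  obtain ⟨ρ, hρ, hρsub⟩ := Metric.isOpen_iff.1 isOpen_ball z hzb
  -- The penalty contributes `δ r²` to the mean, which beats an error of `δ / 2 * r ^ 2`.
  have hev := hv.submean z hzb (δ / 2) (by positivity)
  have hev2 : ∀ᶠ r in 𝓝[>] (0 : ℝ), r ∈ Set.Ioo 0 ρ := Ioo_mem_nhdsGT hρ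
  obtain ⟨r, hr1, hr0, hrρ⟩ := (hev.and hev2).exists
  have hsub : sphere z |r| ⊆ closedBall a R := by
    rw [abs_of_pos hr0]
    exact (sphere_subset_closedBall.trans (closedBall_subset_ball hrρ)).trans
      (hρsub.trans ball_subset_closedBall)
  have hint : CircleIntegrable v z r :=
    circleIntegrable_of_upperSemicontinuousOn (hv.usc.mono hsub) (fun y hy => hN y (hsub hy))
  have hkint : CircleIntegrable k z r := hk.continuousOn.circleIntegrable'
  have havg : circleAverage (fun y => v y + k y) z r ≤ v z + k z :=
    circleAverage_mono_on_of_le_circle (hint.add hkint) (fun y hy => hmax (hsub hy))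
  rw [circleAverage_fun_add hint hkint] at havg
  have hkavg : circleAverage k z r = k z + δ * r ^ 2 := by
    have e : k = fun y => (-δ * R ^ 2 + (-1 : ℝ) * (g y).re) + δ * ‖y - a‖ ^ 2 := by
      funext y; simp only [k]; ring
    have i1 : CircleIntegrable (fun y => (g y).re) z r := by
      have := hg.continuous
      exact (by fun_prop : Continuous fun y => (g y).re).continuousOn.circleIntegrable'
    have i2 : CircleIntegrable (fun y => δ * ‖y - a‖ ^ 2) z r :=
      (by fun_prop : Continuous fun y : ℂ => δ * ‖y - a‖ ^ 2).continuousOn.circleIntegrable'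
    have i3 : CircleIntegrable (fun y => (-1 : ℝ) * (g y).re) z r := i1.const_smul (a := (-1 : ℝ))
    have i4 : CircleIntegrable (fun y => -δ * R ^ 2 + (-1 : ℝ) * (g y).re) z r :=
      (circleIntegrable_const _ _ _).add i3
    rw [e, circleAverage_fun_add i4 i2,
      circleAverage_fun_add (circleIntegrable_const _ _ _) i3, circleAverage_const]
    have e1 := circleAverage_fun_smul (a := (-1 : ℝ)) (f := fun y => (g y).re) (c := z) (R := r)
    have e2 := circleAverage_fun_smul (a := δ) (f := fun y : ℂ => ‖y - a‖ ^ 2) (c := z) (R := r)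
    simp only [smul_eq_mul] at e1 e2
    rw [e1, e2, circleAverage_re_of_differentiable hg, circleAverage_norm_sub_sq]
    ring
  rw [hkavg] at havg
  have : 0 < δ * r ^ 2 := by positivity
  linarith

/-- An upper semicontinuous function bounded below on a circle is a limit of uniformly bounded
continuous majorants. -/
lemma exists_continuous_majorants {v : ℂ → ℝ} {S : Set ℂ} (hS : IsCompact S) (hne : S.Nonempty)
    (husc : UpperSemicontinuousOn v S) {N : ℝ} (hN : ∀ z ∈ S, N ≤ v z) :
    ∃ (c : ℕ → ℂ → ℝ) (B : ℝ), (∀ k, Continuous (c k)) ∧ (∀ k, ∀ z ∈ S, v z ≤ c k z) ∧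
      (∀ k, ∀ z ∈ S, |c k z| ≤ B) ∧ ∀ z ∈ S, Tendsto (fun k => c k z) atTop (𝓝 (v z)) := by
  obtain ⟨B, hB⟩ := husc.bddAbove_of_isCompact hS
  have hB' : ∀ z ∈ S, v z ≤ B := fun z hz => hB (Set.mem_image_of_mem v hz)
  have : Nonempty S := hne.to_subtype
  -- Sup-convolution with cones of slope `k`; it is `k`-Lipschitz.
  let c : ℕ → ℂ → ℝ := fun k z => ⨆ y : S, (v y - k * ‖(y : ℂ) - z‖)
  have hbdd : ∀ (k : ℕ) (z : ℂ), BddAbove (Set.range fun y : S => (v y - k * ‖(y : ℂ) - z‖)) := fun k z =>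
    ⟨B, by
      rintro _ ⟨y, rfl⟩
      have := hB' y y.2
      have : 0 ≤ (k : ℝ) * ‖(y : ℂ) - z‖ := by positivity
      simp only; linarith⟩
  have hge : ∀ k, ∀ z ∈ S, v z ≤ c k z := fun k z hz => by
    have := le_ciSup (hbdd k z) ⟨z, hz⟩
    simpa using this
  have hle : ∀ k z, c k z ≤ B := fun k z => ciSup_le fun y => by
    have := hB' y y.2
    have : 0 ≤ (k : ℝ) * ‖(y : ℂ) - z‖ := by positivity
    linarith
  refine ⟨c, max |N| |B|, fun k => ?_, hge, fun k z hz =>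
    abs_le_max_abs_abs ((hN z hz).trans (hge k z hz)) (hle k z), fun z hz => ?_⟩
  · have : LipschitzWith (k : NNReal) (c k) := by
      refine LipschitzWith.of_le_add_mul _ fun z w => ciSup_le fun y => ?_
      have h1 := le_ciSup (hbdd k w) y
      have h2 : ‖(y : ℂ) - w‖ ≤ ‖(y : ℂ) - z‖ + dist z w := by
        rw [dist_eq_norm, ← sub_add_sub_cancel (y : ℂ) z w]; exact norm_add_le _ _
      have h3 : (k : ℝ) * ‖(y : ℂ) - w‖ ≤ k * (‖(y : ℂ) - z‖ + dist z w) := by gcongr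
      simp only [NNReal.coe_natCast]
      have h4 : c k w = ⨆ y : S, (v y - k * ‖(y : ℂ) - w‖) := rfl
      rw [← h4] at h1
      linarith
    exact this.continuous
  · rw [Metric.tendsto_atTop]
    intro η hη
    have h1 := husc z hz (v z + η / 2) (by linarith)
    rw [eventually_nhdsWithin_iff, Metric.eventually_nhds_iff] at h1
    obtain ⟨δ, hδ, h1⟩ := h1
    -- For slopes `≥ K`, points at distance at least `δ` lose more than `B - N`, hence compete below
    -- `N ≤ v z`.
    obtain ⟨K, hK⟩ := exists_nat_gt ((B - N) / δ)
    refine ⟨K, fun k hk => ?_⟩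
    have hle2 : c k z ≤ v z + η / 2 := ciSup_le fun y => by
      have hk0 : 0 ≤ (k : ℝ) * ‖(y : ℂ) - z‖ := by positivity
      by_cases hy : dist (y : ℂ) z < δ
      · have := h1 hy y.2
        linarith
      · push Not at hy
        have h2 : B - N < K * δ := by rwa [div_lt_iff₀ hδ] at hK
        have h3 : (K : ℝ) * δ ≤ k * ‖(y : ℂ) - z‖ := by
          rw [dist_eq_norm] at hy
          have : (K : ℝ) ≤ k := by exact_mod_cast hk
          gcongr
        have := hB' y y.2
        have := hN z hz
        linarith
    rw [Real.dist_eq, abs_lt]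
    constructor <;> linarith [hge k z hz]

/-- The asymptotic local sub-mean value property implies the sub-mean value inequality. -/
theorem AsymptoticSubmeanOn.le_circleAverage {v : ℂ → ℝ} {a : ℂ} {R : ℝ}
    (hv : AsymptoticSubmeanOn v a R) (hR : 0 < R) : v a ≤ circleAverage v a R := by
  obtain ⟨N, hN⟩ := hv.bddBelow
  obtain ⟨c, B, hc, hge, hbd, hlim⟩ := exists_continuous_majorants (isCompact_sphere a R)
    (NormedSpace.sphere_nonempty.2 hR.le) (hv.usc.mono sphere_subset_closedBall)
    (fun z hz => hN z (sphere_subset_closedBall hz))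
  have h1 : ∀ k, v a ≤ circleAverage (c k) a R := fun k => by
    refine le_of_forall_pos_le_add fun η hη => ?_
    obtain ⟨g, hg, hgc⟩ := exists_differentiable_re_near (hc k) a hR (half_pos hη)
    -- The shift by `η / 2` makes the real part a majorant of `c k`, hence of `v`, on the circle.
    have h2 := hv.le_re hR (g := fun z => g z + (η / 2 : ℝ)) (by fun_prop) (fun z hz => by
      have := abs_le.1 (hgc z hz)
      have := hge k z hz
      simp only [Complex.add_re, Complex.ofReal_re]
      linarith)
    have h3 : circleAverage (fun w => (g w).re) a R ≤ circleAverage (fun w => c k w + η / 2) a R := by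
      refine circleAverage_mono ?_ ?_ fun z hz => ?_
      · exact (Complex.continuous_re.comp hg.continuous).continuousOn.circleIntegrable'
      · exact ((hc k).add continuous_const).continuousOn.circleIntegrable'
      · rw [abs_of_pos hR] at hz
        linarith [abs_le.1 (hgc z hz)]
    rw [circleAverage_re_of_differentiable hg, circleAverage_fun_add
      (hc k).continuousOn.circleIntegrable' (circleIntegrable_const _ _ _),
      circleAverage_const] at h3
    simp only [Complex.add_re, Complex.ofReal_re] at h2
    linarith
  suffices h : Tendsto (fun k => circleAverage (c k) a R) atTop (𝓝 (circleAverage v a R)) from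
    ge_of_tendsto' h h1
  unfold circleAverage
  refine Tendsto.const_smul ?_ _
  refine intervalIntegral.tendsto_integral_filter_of_dominated_convergence (fun _ => B) ?_ ?_ ?_ ?_
  · exact Eventually.of_forall fun k =>
      ((hc k).comp (continuous_circleMap a R)).aestronglyMeasurable
  · exact Eventually.of_forall fun k => Eventually.of_forall fun θ _ =>
      hbd k _ (circleMap_mem_sphere a hR.le θ)
  · exact intervalIntegrable_const
  · exact Eventually.of_forall fun θ _ => hlim _ (circleMap_mem_sphere a hR.le θ)

end OneVariable

/-! ### Mollification of plurisubharmonic functions. -/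

section Smoothing

open Metric Filter Topology Real MeasureTheory

variable {m : ℕ}

/-- Real-valued plurisubharmonic functions on `ℂᵐ` which are bounded below. -/
structure IsRealPsh (U : (Fin m → ℂ) → ℝ) : Prop where
  usc : UpperSemicontinuous U
  bddBelow : ∃ N : ℝ, ∀ x, N ≤ U x
  submean : ∀ a b, U a ≤ circleAverage (fun ζ => U (a + ζ • b)) 0 1

lemma IsRealPsh.exists_abs_le {U : (Fin m → ℂ) → ℝ} (hU : IsRealPsh U) {K : Set (Fin m → ℂ)}
    (hK : IsCompact K) : ∃ B, ∀ x ∈ K, |U x| ≤ B := by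
  obtain ⟨N, hN⟩ := hU.bddBelow
  obtain ⟨B, hB⟩ := (hU.usc.upperSemicontinuousOn K).bddAbove_of_isCompact hK
  exact ⟨max |N| |B|, fun x hx =>
    abs_le_max_abs_abs (hN x) (hB (Set.mem_image_of_mem U hx))⟩

/-- Circle invariant `C¹` mollifiers with support in the closed ball of radius `ε`. -/
structure IsMollifier (χ : (Fin m → ℂ) → ℝ) (ε : ℝ) : Prop where
  contDiff : ContDiff ℝ 1 χ
  compactSupport : HasCompactSupport χ
  nonneg : ∀ t, 0 ≤ χ t
  integral_eq_one : ∫ t, χ t = 1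
  norm_le : ∀ t, χ t ≠ 0 → ‖t‖ ≤ ε
  rotate : ∀ c : ℂ, ‖c‖ = 1 → ∀ t, χ (c • t) = χ t

lemma IsMollifier.integrable {χ : (Fin m → ℂ) → ℝ} {ε : ℝ} (hχ : IsMollifier χ ε) :
    Integrable χ :=
  hχ.contDiff.continuous.integrable_of_hasCompactSupport hχ.compactSupport

lemma exists_isMollifier (m : ℕ) {ε : ℝ} (hε : 0 < ε) :
    ∃ χ : (Fin m → ℂ) → ℝ, IsMollifier χ ε := by
  -- The norm of `Fin m → ℂ` is the sup norm; the sum of squares is smooth, invariant under unit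
  -- scalars and dominates `‖t‖ ^ 2`.
  let ρ : (Fin m → ℂ) → ℝ := fun t => smoothTransition (1 - (∑ k, ‖t k‖ ^ 2) / ε ^ 2)
  have hρ : ContDiff ℝ 1 ρ := by
    refine (smoothTransition.contDiff (n := 1)).comp ?_
    refine contDiff_const.sub (ContDiff.div_const (ContDiff.sum fun k _ => ?_) _)
    exact (contDiff_norm_sq ℝ).comp (contDiff_apply ℝ ℂ k)
  have hsupp : ∀ t, ρ t ≠ 0 → ‖t‖ ≤ ε := fun t ht => by
    rw [pi_norm_le_iff_of_nonneg hε.le]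
    intro k
    by_contra! hk
    apply ht
    apply smoothTransition.zero_of_nonpos
    have h1 : ‖t k‖ ^ 2 ≤ ∑ k, ‖t k‖ ^ 2 :=
      Finset.single_le_sum (f := fun k => ‖t k‖ ^ 2) (fun _ _ => by positivity)
        (Finset.mem_univ k)
    have h2 : ε ^ 2 ≤ ‖t k‖ ^ 2 := by gcongr
    rw [sub_nonpos, le_div_iff₀ (by positivity)]
    linarith
  have hcs : HasCompactSupport ρ :=
    HasCompactSupport.of_support_subset_isCompact (isCompact_closedBall 0 ε)
      fun t ht => by simpa using hsupp t ht
  have hnn : ∀ t, 0 ≤ ρ t := fun t => smoothTransition.nonneg _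
  have hpos : 0 < ∫ t, ρ t := by
    refine hρ.continuous.integral_pos_of_hasCompactSupport_nonneg_nonzero hcs hnn (x := 0) ?_
    simp [ρ]
  have hrot : ∀ c : ℂ, ‖c‖ = 1 → ∀ t, ρ (c • t) = ρ t := fun c hc t => by simp [ρ, hc]
  clear_value ρ
  obtain ⟨I, hI⟩ : ∃ I, I = ∫ t, ρ t := ⟨_, rfl⟩
  rw [← hI] at hpos
  refine ⟨fun t => I⁻¹ * ρ t, ?_⟩
  constructor
  · exact contDiff_const.mul hρ
  · exact hcs.mul_left
  · intro t
    have := hnn t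
    positivity
  · rw [integral_const_mul, ← hI, inv_mul_cancel₀ hpos.ne']
  · exact fun t ht => hsupp t (right_ne_zero_of_mul ht)
  · intro c hc t
    rw [hrot c hc t]

lemma measurePreserving_smul_of_norm_eq_one {c : ℂ} (hc : ‖c‖ = 1) :
    MeasurePreserving (fun t : Fin m → ℂ => c • t) := by
  refine volume_preserving_pi (f := fun _ z => c * z) fun _ => ?_
  have := (rotation (⟨c, by simpa [Submonoid.unitSphere] using hc⟩ : Circle)).measurePreserving
  exact this

lemma IsRealPsh.integrable_mollifier_mul {U : (Fin m → ℂ) → ℝ} (hU : IsRealPsh U)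
    {χ : (Fin m → ℂ) → ℝ} {ε : ℝ} (hχ : IsMollifier χ ε)
    {Φ : (Fin m → ℂ) → (Fin m → ℂ)} (hΦ : Continuous Φ) :
    Integrable (fun t => χ t * U (Φ t)) := by
  obtain ⟨B, hB⟩ := hU.exists_abs_le ((isCompact_closedBall (0 : Fin m → ℂ) ε).image hΦ)
  refine (hχ.integrable.mul_const B).mono ?_ (Eventually.of_forall fun t => ?_)
  · exact (hχ.contDiff.continuous.measurable.mul
      (hU.usc.measurable.comp hΦ.measurable)).aestronglyMeasurable
  · by_cases ht : χ t = 0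
    · simp [ht]
    · have h1 := hB (Φ t) (Set.mem_image_of_mem _ (by simpa using hχ.norm_le t ht))
      rw [norm_mul, norm_mul]
      gcongr
      exact h1.trans (le_abs_self B)

lemma IsRealPsh.integrable_prod_mollifier_mul {U : (Fin m → ℂ) → ℝ} (hU : IsRealPsh U)
    {χ : (Fin m → ℂ) → ℝ} {ε : ℝ} (hχ : IsMollifier χ ε)
    {Φ : ℝ × (Fin m → ℂ) → (Fin m → ℂ)} (hΦ : Continuous Φ) :
    Integrable (fun p : ℝ × (Fin m → ℂ) => χ p.2 * U (Φ p))
      ((volume.restrict (Set.Ioc 0 (2 * π))).prod volume) := by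
  obtain ⟨B, hB⟩ := hU.exists_abs_le
    (((isCompact_Icc (a := 0) (b := 2 * π)).prod
      (isCompact_closedBall (0 : Fin m → ℂ) ε)).image hΦ)
  have h0 : Integrable (fun p : ℝ × (Fin m → ℂ) => χ p.2 * B)
      ((volume.restrict (Set.Ioc 0 (2 * π))).prod volume) :=
    (hχ.integrable.mul_const B).comp_snd _
  refine h0.mono ?_ ?_
  · exact ((hχ.contDiff.continuous.measurable.comp measurable_snd).mul
      (hU.usc.measurable.comp hΦ.measurable)).aestronglyMeasurable
  · have h1 : ∀ᵐ p ∂((volume.restrict (Set.Ioc 0 (2 * π))).prod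
        (volume : Measure (Fin m → ℂ))), p.1 ∈ Set.Ioc 0 (2 * π) :=
      Measure.quasiMeasurePreserving_fst.ae (ae_restrict_mem measurableSet_Ioc)
    filter_upwards [h1] with p hp
    by_cases ht : χ p.2 = 0
    · simp [ht]
    · have h1 := hB (Φ p) (Set.mem_image_of_mem _
        ⟨Set.Ioc_subset_Icc_self hp, by simpa using hχ.norm_le p.2 ht⟩)
      rw [norm_mul, norm_mul]
      gcongr
      exact h1.trans (le_abs_self B)

/-- The regularization `∫ χ(t) U(x - t) dt`. -/
noncomputable def mollify (χ U : (Fin m → ℂ) → ℝ) (x : Fin m → ℂ) : ℝ := ∫ t, χ t * U (x - t)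

/-- Fubini. The map `Ψ` is left free to cover both translates `a + ζ • b - t` and rotations `x - ζ •
t`. -/
lemma IsRealPsh.circleAverage_integral_mollifier {U : (Fin m → ℂ) → ℝ} (hU : IsRealPsh U)
    {χ : (Fin m → ℂ) → ℝ} {ε : ℝ} (hχ : IsMollifier χ ε)
    {Ψ : ℂ × (Fin m → ℂ) → (Fin m → ℂ)} (hΨ : Continuous Ψ) :
    circleAverage (fun ζ => ∫ t, χ t * U (Ψ (ζ, t))) 0 1 =
      ∫ t, χ t * circleAverage (fun ζ => U (Ψ (ζ, t))) 0 1 ∧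
    Integrable (fun t => χ t * circleAverage (fun ζ => U (Ψ (ζ, t))) 0 1) := by
  have hΦ : Continuous (fun p : ℝ × (Fin m → ℂ) => Ψ (circleMap 0 1 p.1, p.2)) :=
    hΨ.comp (((continuous_circleMap 0 1).comp continuous_fst).prodMk continuous_snd)
  have hint := hU.integrable_prod_mollifier_mul hχ hΦ
  have e : ∀ t, χ t * circleAverage (fun ζ => U (Ψ (ζ, t))) 0 1 =
      (2 * π)⁻¹ * ∫ θ in Set.Ioc 0 (2 * π), χ t * U (Ψ (circleMap 0 1 θ, t)) := fun t => by
    rw [circleAverage, intervalIntegral.integral_of_le two_pi_pos.le, integral_const_mul,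
      smul_eq_mul]
    ring
  simp only [e]
  constructor
  · rw [circleAverage, intervalIntegral.integral_of_le two_pi_pos.le, integral_const_mul,
      smul_eq_mul, integral_integral_swap]
    exact hint
  · exact hint.integral_prod_right.const_mul _

lemma IsRealPsh.mollify_submean {U : (Fin m → ℂ) → ℝ} (hU : IsRealPsh U)
    {χ : (Fin m → ℂ) → ℝ} {ε : ℝ} (hχ : IsMollifier χ ε) (a b : Fin m → ℂ) :
    mollify χ U a ≤ circleAverage (fun ζ => mollify χ U (a + ζ • b)) 0 1 := by
  obtain ⟨h1, h2⟩ := hU.circleAverage_integral_mollifier hχ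
    (Ψ := fun p => a + p.1 • b - p.2) (by fun_prop)
  unfold mollify
  rw [h1]
  refine integral_mono (hU.integrable_mollifier_mul hχ (by fun_prop)) h2 fun t => ?_
  have h3 := hU.submean (a - t) b
  simp only [add_sub_right_comm]
  exact mul_le_mul_of_nonneg_left h3 (hχ.nonneg t)

/-- By circle invariance of the kernel, replacing `t` by `ζ • t` in the argument of `U` leaves the
integral unchanged. Averaging over `ζ` first gives, for each `t`, a circle mean around `x`, which is
at least `U x`. -/
lemma IsRealPsh.le_mollify {U : (Fin m → ℂ) → ℝ} (hU : IsRealPsh U)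
    {χ : (Fin m → ℂ) → ℝ} {ε : ℝ} (hχ : IsMollifier χ ε) (x : Fin m → ℂ) :
    U x ≤ mollify χ U x := by
  obtain ⟨h1, h2⟩ := hU.circleAverage_integral_mollifier hχ
    (Ψ := fun p => x + p.1 • (-p.2)) (by fun_prop)
  have h3 : ∀ ζ ∈ sphere (0 : ℂ) |1|, ∫ t, χ t * U (x + ζ • (-t)) = mollify χ U x := fun ζ hζ => by
    have hζ1 : ‖ζ‖ = 1 := by simpa using hζ
    have h4 := (measurePreserving_smul_of_norm_eq_one (m := m) hζ1).integral_comp'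
      (f := (Homeomorph.smulOfNeZero ζ (by rintro rfl; simp at hζ1)).toMeasurableEquiv)
      (fun t => χ t * U (x - t))
    unfold mollify
    rw [← h4]
    refine integral_congr_ae (Eventually.of_forall fun t => ?_)
    simp [hχ.rotate ζ hζ1, sub_eq_add_neg]
  have h5 : circleAverage (fun ζ => ∫ t, χ t * U (x + ζ • (-t))) 0 1 = mollify χ U x :=
    circleAverage_const_on_circle h3
  rw [← h5, h1]
  calc U x = ∫ t, χ t * U x := by rw [integral_mul_const, hχ.integral_eq_one, one_mul]
    _ ≤ _ := integral_mono (hχ.integrable.mul_const _) h2 fun t =>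
      mul_le_mul_of_nonneg_left (hU.submean x (-t)) (hχ.nonneg t)

lemma IsRealPsh.mollify_le {U : (Fin m → ℂ) → ℝ} (hU : IsRealPsh U)
    {χ : (Fin m → ℂ) → ℝ} {ε : ℝ} (hχ : IsMollifier χ ε) {x : Fin m → ℂ} {s : ℝ}
    (hs : ∀ t : Fin m → ℂ, ‖t‖ ≤ ε → U (x - t) ≤ s) : mollify χ U x ≤ s := by
  calc mollify χ U x ≤ ∫ t, χ t * s := by
        refine integral_mono (hU.integrable_mollifier_mul hχ (by fun_prop))
          (hχ.integrable.mul_const _) fun t => ?_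
        by_cases ht : χ t = 0
        · simp [ht]
        · exact mul_le_mul_of_nonneg_left (hs t (hχ.norm_le t ht)) (hχ.nonneg t)
    _ = s := by rw [integral_mul_const, hχ.integral_eq_one, one_mul]

lemma IsRealPsh.contDiff_mollify {U : (Fin m → ℂ) → ℝ} (hU : IsRealPsh U)
    {χ : (Fin m → ℂ) → ℝ} {ε : ℝ} (hχ : IsMollifier χ ε) : ContDiff ℝ 1 (mollify χ U) := by
  have hloc : LocallyIntegrable U := by
    rw [locallyIntegrable_iff]
    intro K hK
    obtain ⟨B, hB⟩ := hU.exists_abs_le hK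
    exact Measure.integrableOn_of_bounded hK.measure_lt_top.ne
      hU.usc.measurable.aestronglyMeasurable
      (ae_restrict_of_forall_mem hK.measurableSet hB)
  exact hχ.compactSupport.contDiff_convolution_left (n := 1) (ContinuousLinearMap.lsmul ℝ ℝ)
    hχ.contDiff hloc

end Smoothing

/-! ### Sub-mean values along holomorphic discs. -/

section Composition

open Metric Filter Topology Real MeasureTheory

variable {m : ℕ}

lemma AnalyticAt.exists_isBigO_sub_affine {q : ℂ → Fin m → ℂ} {z : ℂ} (hq : AnalyticAt ℂ q z) :
    ∃ b : Fin m → ℂ, (fun s => q (z + s) - q z - s • b) =O[𝓝 0] fun s => ‖s‖ ^ 2 := by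
  obtain ⟨p, hp⟩ := hq
  refine ⟨p.coeff 1, ?_⟩
  have h := hp.isBigO_sub_partialSum_pow 2
  refine h.congr_left fun s => ?_
  have h0 : (p 0 fun _ => s) = q z := by rw [hp.coeff_zero]
  rw [FormalMultilinearSeries.partialSum, Finset.sum_range_succ, Finset.sum_range_one, h0,
    FormalMultilinearSeries.apply_eq_pow_smul_coeff]
  simp [sub_sub]

/-- A `C¹` function with the sub-mean value property on affine circles has asymptotically the
sub-mean value property along holomorphic curves. -/
lemma eventually_le_circleAverage_comp {V : (Fin m → ℂ) → ℝ} (hV : ContDiff ℝ 1 V)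
    (hsub : ∀ a b, V a ≤ circleAverage (fun ζ => V (a + ζ • b)) 0 1)
    {q : ℂ → Fin m → ℂ} {O : Set ℂ} (hO : IsOpen O) (hq : DifferentiableOn ℂ q O) {z : ℂ}
    (hz : z ∈ O) {δ : ℝ} (hδ : 0 < δ) :
    ∀ᶠ r in 𝓝[>] (0 : ℝ), V (q z) ≤ circleAverage (V ∘ q) z r + δ * r ^ 2 := by
  obtain ⟨b, hb⟩ := (hq.analyticAt (hO.mem_nhds hz)).exists_isBigO_sub_affine
  obtain ⟨C, hC, hb⟩ := hb.exists_pos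
  -- Strict differentiability compares the two moving points `q (z + s)` and `q z + s • b`. Their
  -- distance is at most `C ‖s‖ ^ 2`, so the constant `δ / C` yields an error `δ r ^ 2`;
  -- differentiability at `q z` alone would give only `o(r)`.
  have hstrict := hV.contDiffAt.hasStrictFDerivAt (x := q z) (by norm_num)
  set L := fderiv ℝ V (q z)
  have hlo := hstrict.isLittleO.def (c := δ / C) (by positivity)
  have hqc : ContinuousAt q z := hq.continuousOn.continuousAt (hO.mem_nhds hz)
  have htend : Tendsto (fun s : ℂ => (q (z + s), q z + s • b)) (𝓝 0) (𝓝 (q z, q z)) := by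
    have h1 : ContinuousAt (fun s : ℂ => (q (z + s), q z + s • b)) 0 := by
      refine ContinuousAt.prodMk ?_ (by fun_prop)
      refine ContinuousAt.comp (g := q) (f := fun s => z + s) (by simpa using hqc) (by fun_prop)
    simpa [ContinuousAt] using h1
  have hO' : ∀ᶠ s in 𝓝 (0 : ℂ), z + s ∈ O := by
    have : Tendsto (fun s : ℂ => z + s) (𝓝 0) (𝓝 z) := by
      simpa using (continuous_const_add z).tendsto 0
    exact this.eventually (hO.mem_nhds hz)
  obtain ⟨ρ, hρ, hball⟩ := Metric.eventually_nhds_iff.1 ((htend.eventually hlo).and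
    (hb.bound.and hO'))
  filter_upwards [Ioo_mem_nhdsGT hρ] with r hr
  have hr0 : 0 < r := hr.1
  set e : ℂ → Fin m → ℂ := fun w => q w - q z - (w - z) • b with he
  have hcb : closedBall z r ⊆ O := fun w hw => by
    have := (hball (y := w - z) (by
      rw [dist_zero_right, ← dist_eq_norm]; exact (mem_closedBall.1 hw).trans_lt hr.2)).2.2
    simpa using this
  have hqcont : ContinuousOn q (sphere z |r|) := hq.continuousOn.mono (by
    rw [abs_of_pos hr0]; exact sphere_subset_closedBall.trans hcb)
  have hec : ContinuousOn e (sphere z |r|) := by fun_prop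
  have hVc : Continuous V := hV.continuous
  have i1 : CircleIntegrable (fun w => V (q z + (w - z) • b)) z r :=
    (by fun_prop : Continuous fun w : ℂ => V (q z + (w - z) • b)).continuousOn.circleIntegrable'
  have i2 : CircleIntegrable (fun w => L (e w)) z r :=
    (L.continuous.comp_continuousOn hec).circleIntegrable'
  have i3 : CircleIntegrable (fun w => V (q z + (w - z) • b) + L (e w)) z r := i1.add i2
  have i4 : CircleIntegrable (V ∘ q) z r := (hVc.comp_continuousOn hqcont).circleIntegrable'
  have hmono : circleAverage (fun w => V (q z + (w - z) • b) + L (e w)) z r ≤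
      circleAverage (fun w => (V ∘ q) w + δ * r ^ 2) z r := by
    refine circleAverage_mono i3 (i4.add (circleIntegrable_const _ _ _)) fun w hw => ?_
    have hwr : ‖w - z‖ = r := by rwa [mem_sphere_iff_norm, abs_of_pos hr0] at hw
    obtain ⟨h1, h2, -⟩ := hball (y := w - z) (by rw [dist_zero_right, hwr]; exact hr.2)
    have e1 : z + (w - z) = w := by ring
    have e2 : q w - (q z + (w - z) • b) = e w := by rw [he]; simp only; abel
    simp only [e1, e2, hwr] at h1 h2
    have e3 : q w - q z - (w - z) • b = e w := rfl
    rw [e3] at h2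
    simp only [norm_pow, norm_of_nonneg hr0.le] at h2
    have h3 : δ / C * ‖e w‖ ≤ δ * r ^ 2 := by
      calc δ / C * ‖e w‖ ≤ δ / C * (C * r ^ 2) := by gcongr
        _ = δ * r ^ 2 := by field_simp
    have h4 := abs_le.1 (Real.norm_eq_abs _ ▸ h1)
    simp only [Function.comp_apply]
    linarith [h4.1]
  rw [circleAverage_fun_add i1 i2, circleAverage_fun_add i4 (circleIntegrable_const _ _ _),
    circleAverage_const] at hmono
  -- The deviation `e` is holomorphic and vanishes at the centre, so its mean is zero, and `L`
  -- commutes with means.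
  have hL : circleAverage (fun w => L (e w)) z r = 0 := by
    have h1 := L.circleAverage_comp_comm (f := e) (c := z) (R := r) hec.circleIntegrable'
    have hd : DiffContOnCl ℂ e (ball z |r|) := by
      refine DifferentiableOn.diffContOnCl ?_
      rw [closure_ball _ (by simpa using hr0.ne'), abs_of_pos hr0]
      have := hq.mono hcb
      fun_prop
    rw [hd.circleAverage] at h1
    have h2 : e z = 0 := by simp [he]
    rw [h2, map_zero] at h1
    exact h1
  have hA : V (q z) ≤ circleAverage (fun w => V (q z + (w - z) • b)) z r := by
    rw [circleAverage_eq_circleAverage_zero_one]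
    have := hsub (q z) ((r : ℂ) • b)
    simpa only [smul_smul, zero_add, mul_comm, add_sub_cancel_left, add_sub_cancel_right] using this
  linarith

/-- Plurisubharmonic functions satisfy the sub-mean value inequality along holomorphic discs. -/
theorem IsRealPsh.le_circleAverage_comp {U : (Fin m → ℂ) → ℝ} (hU : IsRealPsh U)
    {q : ℂ → Fin m → ℂ} {O : Set ℂ} (hO : IsOpen O) (hq : DifferentiableOn ℂ q O) {z : ℂ} {r : ℝ}
    (hr : 0 < r) (hz : closedBall z r ⊆ O) :
    U (q z) ≤ circleAverage (U ∘ q) z r := by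
  choose χ hχ using fun k : ℕ => exists_isMollifier m (ε := 1 / ((k : ℝ) + 1)) (by positivity)
  have hqc : ContinuousOn q (closedBall z r) := hq.continuousOn.mono hz
  have hVc : ∀ k, Continuous (mollify (χ k) U) := fun k =>
    (hU.contDiff_mollify (hχ k)).continuous
  have h1 : ∀ k, U (q z) ≤ circleAverage (mollify (χ k) U ∘ q) z r := fun k => by
    refine (hU.le_mollify (hχ k) (q z)).trans ?_
    have hVq : ContinuousOn (mollify (χ k) U ∘ q) (closedBall z r) :=
      (hVc k).comp_continuousOn hqc
    obtain ⟨N, hN⟩ := hU.bddBelow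
    refine AsymptoticSubmeanOn.le_circleAverage (v := mollify (χ k) U ∘ q) ⟨?_, ?_, ?_⟩ hr
    · exact hVq.upperSemicontinuousOn
    · exact ⟨N, fun w _ => (hN _).trans (hU.le_mollify (hχ k) _)⟩
    · intro w hw δ hδ
      exact eventually_le_circleAverage_comp (hU.contDiff_mollify (hχ k))
        (hU.mollify_submean (hχ k)) hO hq (hz (ball_subset_closedBall hw)) hδ
  obtain ⟨B, hB⟩ := hU.exists_abs_le (K := (fun p : (Fin m → ℂ) × (Fin m → ℂ) => p.1 - p.2) ''
    ((q '' closedBall z r) ×ˢ closedBall 0 1))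
    ((((isCompact_closedBall z r).image_of_continuousOn hqc).prod
      (isCompact_closedBall 0 1)).image (by fun_prop))
  have hUB : ∀ w ∈ closedBall z r, ∀ t : Fin m → ℂ, ‖t‖ ≤ 1 → |U (q w - t)| ≤ B :=
    fun w hw t ht => hB _ ⟨(q w, t), ⟨Set.mem_image_of_mem q hw, by simpa using ht⟩, rfl⟩
  have hε1 : ∀ k : ℕ, 1 / ((k : ℝ) + 1) ≤ 1 := fun k => by
    rw [div_le_one (by positivity)]
    linarith [(Nat.cast_nonneg k : (0 : ℝ) ≤ k)]
  -- Dominated convergence: the mollification lies between `U x` and the supremum of `U` near `x`,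
  -- and upper semicontinuity closes the gap.
  suffices h : Tendsto (fun k => circleAverage (mollify (χ k) U ∘ q) z r) atTop
      (𝓝 (circleAverage (U ∘ q) z r)) from ge_of_tendsto' h h1
  have hmem : ∀ θ, circleMap z r θ ∈ closedBall z r := fun θ =>
    sphere_subset_closedBall (circleMap_mem_sphere z hr.le θ)
  unfold circleAverage
  refine Tendsto.const_smul ?_ _
  refine intervalIntegral.tendsto_integral_filter_of_dominated_convergence (fun _ => B) ?_ ?_ ?_ ?_
  · refine Eventually.of_forall fun k => Continuous.aestronglyMeasurable ?_
    exact (hVc k).comp (hqc.comp_continuous (continuous_circleMap z r) hmem)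
  · refine Eventually.of_forall fun k => Eventually.of_forall fun θ _ => ?_
    simp only [Function.comp_apply, Real.norm_eq_abs]
    refine abs_le.2 ⟨?_, ?_⟩
    · have := hUB _ (hmem θ) 0 (by simp)
      rw [sub_zero] at this
      exact (abs_le.1 this).1.trans (hU.le_mollify (hχ k) _)
    · exact hU.mollify_le (hχ k) fun t ht =>
        (abs_le.1 (hUB _ (hmem θ) t (ht.trans (hε1 k)))).2
  · exact intervalIntegrable_const
  · refine Eventually.of_forall fun θ _ => ?_
    simp only [Function.comp_apply]
    set x := q (circleMap z r θ)
    rw [Metric.tendsto_atTop]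
    intro η hη
    have h2 := hU.usc x (U x + η / 2) (by linarith)
    obtain ⟨δ, hδ, h2⟩ := Metric.eventually_nhds_iff.1 h2
    obtain ⟨K, hK⟩ := exists_nat_one_div_lt hδ
    refine ⟨K, fun k hk => ?_⟩
    have h3 : mollify (χ k) U x ≤ U x + η / 2 := by
      refine hU.mollify_le (hχ k) fun t ht => (h2 ?_).le
      have h4 : 1 / ((k : ℝ) + 1) ≤ 1 / ((K : ℝ) + 1) := by
        have : (K : ℝ) ≤ k := by exact_mod_cast hk
        gcongr
      rw [dist_eq_norm]
      simpa using (ht.trans h4).trans_lt hK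
    rw [Real.dist_eq, abs_lt]
    constructor <;> linarith [hU.le_mollify (hχ k) x]

end Composition

/-! ### Truncation of extended-real functions and of their means. -/

section Truncation

open Metric Filter Topology Real MeasureTheory

lemma EReal.coe_max_coe (r s : ℝ) : ((max r s : ℝ) : EReal) = max (r : EReal) s :=
  EReal.coe_strictMono.monotone.map_max

/-- The truncation `max (x, s)` of an extended real number from below, as a real number. -/
noncomputable def EReal.trunc (s : ℝ) (x : EReal) : ℝ := (max x s).toReal

lemma EReal.coe_trunc (s : ℝ) {x : EReal} (hx : x < ⊤) : (x.trunc s : EReal) = max x s := by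
  refine EReal.coe_toReal (max_lt hx (EReal.coe_lt_top s)).ne ?_
  exact ((EReal.bot_lt_coe s).trans_le (le_max_right _ _)).ne'

@[simp] lemma EReal.trunc_coe (s r : ℝ) : (r : EReal).trunc s = max r s := by
  rw [← EReal.coe_eq_coe_iff, EReal.coe_trunc s (EReal.coe_lt_top r), EReal.coe_max_coe]

@[simp] lemma EReal.trunc_bot (s : ℝ) : (⊥ : EReal).trunc s = s := by
  rw [← EReal.coe_eq_coe_iff, EReal.coe_trunc s bot_lt_top]
  simp

lemma EReal.le_trunc (s : ℝ) {x : EReal} (hx : x < ⊤) : s ≤ x.trunc s := by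
  rw [← EReal.coe_le_coe_iff, EReal.coe_trunc s hx]
  exact le_max_right _ _

lemma EReal.trunc_eq_max {s s' : ℝ} (h : s' ≤ s) {x : EReal} (hx : x < ⊤) :
    x.trunc s = max (x.trunc s') s := by
  induction x with
  | bot => simp [h]
  | coe r => simp [max_assoc, h]
  | top => exact absurd hx (lt_irrefl _)

/-- An inner truncation this low is hidden by the outer one. Only an inequality on `c` is required,
so one `s'` serves for all values of a function bounded above. -/
lemma EReal.trunc_add_coe {s s' c : ℝ} (h : s' + c ≤ s) {x : EReal} (hx : x < ⊤) :
    (x + c).trunc s = max (x.trunc s' + c) s := by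
  induction x with
  | bot => simp [h]
  | coe r =>
    rw [← EReal.coe_add, EReal.trunc_coe, EReal.trunc_coe, ← max_add_add_right, max_assoc,
      max_eq_right h]
  | top => exact absurd hx (lt_irrefl _)

lemma EReal.trunc_mul_add_coe {s c d : ℝ} (hc : 0 < c) {x : EReal} (hx : x < ⊤) :
    (c * x + d).trunc s = c * x.trunc ((s - d) / c) + d := by
  induction x with
  | bot =>
    rw [EReal.coe_mul_bot_of_pos hc, EReal.bot_add, EReal.trunc_bot, EReal.trunc_bot]
    field_simp
    ring
  | coe r =>
    rw [← EReal.coe_mul, ← EReal.coe_add, EReal.trunc_coe, EReal.trunc_coe,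
      mul_max_of_nonneg _ _ hc.le, ← max_add_add_right]
    congr 1
    field_simp
    ring
  | top => exact absurd hx (lt_irrefl _)

lemma EReal.measurable_trunc (s : ℝ) : Measurable (EReal.trunc s) :=
  (measurable_id.max measurable_const).ereal_toReal

lemma upperSemicontinuous_trunc {X : Type*} [TopologicalSpace X] {u : X → EReal}
    (hu : UpperSemicontinuous u) (hlt : ∀ x, u x < ⊤) (s : ℝ) :
    UpperSemicontinuous fun x => (u x).trunc s := by
  intro x y hy
  have hy : (u x).trunc s < y := hy
  rw [← EReal.coe_lt_coe_iff, EReal.coe_trunc s (hlt x), max_lt_iff] at hy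
  filter_upwards [hu x y hy.1] with z hz
  rw [← EReal.coe_lt_coe_iff, EReal.coe_trunc s (hlt z)]
  exact max_lt hz hy.2

lemma EReal.ofReal_trunc {s : ℝ} (hs : s ≤ 0) {x : EReal} (hx : x < ⊤) :
    ENNReal.ofReal (x.trunc s) = x.toENNReal := by
  induction x with
  | bot => simp [hs]
  | coe r =>
    rw [EReal.trunc_coe, EReal.real_coe_toENNReal, ENNReal.ofReal_max,
      ENNReal.ofReal_of_nonpos hs]
    simp
  | top => exact absurd hx (lt_irrefl _)

lemma EReal.ofReal_neg_trunc {s : ℝ} {x : EReal} (hx : x < ⊤) :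
    ENNReal.ofReal (-x.trunc s) = min (-x).toENNReal (ENNReal.ofReal (-s)) := by
  induction x with
  | bot => simp
  | coe r =>
    rw [EReal.trunc_coe, ← EReal.coe_neg, EReal.real_coe_toENNReal, ← ENNReal.ofReal_min]
    congr 1
    rcases le_total r s with h | h <;> simp [h]
  | top => exact absurd hx (lt_irrefl _)

variable {Ω : Type*} [MeasurableSpace Ω] {ν : Measure Ω} [IsProbabilityMeasure ν]

lemma integrable_trunc {w : Ω → EReal} (hw : Measurable w) {B : ℝ} (hB : ∀ᵐ x ∂ν, w x ≤ B) (s : ℝ) :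
    Integrable (fun x => (w x).trunc s) ν := by
  refine Integrable.of_bound ((EReal.measurable_trunc s).comp hw).aestronglyMeasurable
    (max |s| |max B s|) ?_
  filter_upwards [hB] with x hx
  have hlt := hx.trans_lt (EReal.coe_lt_top B)
  refine abs_le_max_abs_abs (EReal.le_trunc s hlt) ?_
  rw [← EReal.coe_le_coe_iff, EReal.coe_trunc s hlt, EReal.coe_max_coe]
  exact max_le_max_right _ hx

/-- Truncating at a level `s ≤ 0` leaves the positive part alone and caps the negative part at `-s`.
-/
lemma coe_integral_trunc {w : Ω → EReal} (hw : Measurable w) {B : ℝ} (hB : ∀ᵐ x ∂ν, w x ≤ B)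
    {s : ℝ} (hs : s ≤ 0) :
    ((∫ x, (w x).trunc s ∂ν : ℝ) : EReal) =
      ((∫⁻ x, (w x).toENNReal ∂ν : ENNReal) : EReal) -
        ((∫⁻ x, min (-w x).toENNReal (ENNReal.ofReal (-s)) ∂ν : ENNReal) : EReal) := by
  have hint := integrable_trunc hw hB s
  have hlt : ∀ᵐ x ∂ν, w x < ⊤ := hB.mono fun x hx => hx.trans_lt (EReal.coe_lt_top B)
  have e1 : ∫⁻ x, ENNReal.ofReal ((w x).trunc s) ∂ν = ∫⁻ x, (w x).toENNReal ∂ν :=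
    lintegral_congr_ae (hlt.mono fun x hx => EReal.ofReal_trunc hs hx)
  have e2 : ∫⁻ x, ENNReal.ofReal (-(w x).trunc s) ∂ν =
      ∫⁻ x, min (-w x).toENNReal (ENNReal.ofReal (-s)) ∂ν :=
    lintegral_congr_ae (hlt.mono fun x hx => EReal.ofReal_neg_trunc hx)
  have f1 := hint.lintegral_lt_top
  have f2 := hint.neg.lintegral_lt_top
  simp only [Pi.neg_apply] at f2
  rw [integral_eq_lintegral_pos_part_sub_lintegral_neg_part hint, ← e1, ← e2, EReal.coe_sub,
    EReal.coe_ennreal_toReal f1.ne, EReal.coe_ennreal_toReal f2.ne]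

lemma integral_trunc_le_of_le_sub {w : Ω → EReal} (hw : Measurable w) {B : ℝ}
    (hB : ∀ᵐ x ∂ν, w x ≤ B) {s : ℝ} (hs : s ≤ 0) {t : EReal} (ht : t < ⊤)
    (h : t ≤ ((∫⁻ x, (w x).toENNReal ∂ν : ENNReal) : EReal) -
        ((∫⁻ x, (-w x).toENNReal ∂ν : ENNReal) : EReal)) :
    t.trunc s ≤ ∫ x, (w x).trunc s ∂ν := by
  rw [← EReal.coe_le_coe_iff, EReal.coe_trunc s ht]
  refine max_le ?_ ?_
  · rw [coe_integral_trunc hw hB hs]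
    refine h.trans (EReal.sub_le_sub le_rfl ?_)
    exact_mod_cast lintegral_mono fun x => min_le_left _ _
  · rw [EReal.coe_le_coe_iff]
    calc s = ∫ _, s ∂ν := by simp
      _ ≤ _ := integral_mono_ae (integrable_const _) (integrable_trunc hw hB s)
        (hB.mono fun x hx => EReal.le_trunc s (hx.trans_lt (EReal.coe_lt_top B)))

/-- Monotone convergence in the negative part as the level tends to `-∞`. The bound `B` keeps the
positive part finite, so the difference is continuous there. -/
lemma le_sub_of_integral_trunc_le {w : Ω → EReal} (hw : Measurable w) {B : ℝ}
    (hB : ∀ᵐ x ∂ν, w x ≤ B) {t : EReal} (ht : t < ⊤)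
    (h : ∀ s ≤ 0, t.trunc s ≤ ∫ x, (w x).trunc s ∂ν) :
    t ≤ ((∫⁻ x, (w x).toENNReal ∂ν : ENNReal) : EReal) -
        ((∫⁻ x, (-w x).toENNReal ∂ν : ENNReal) : EReal) := by
  have hP : (∫⁻ x, (w x).toENNReal ∂ν) ≠ ⊤ := by
    have h1 : ∫⁻ x, (w x).toENNReal ∂ν ≤ ∫⁻ _, ENNReal.ofReal B ∂ν :=
      lintegral_mono_ae (hB.mono fun x hx => EReal.toENNReal_le_toENNReal hx)
    simp only [lintegral_const, measure_univ, mul_one] at h1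
    exact (h1.trans_lt ENNReal.ofReal_lt_top).ne
  have hk : ∀ k : ℕ, t ≤ ((∫⁻ x, (w x).toENNReal ∂ν : ENNReal) : EReal) -
      ((∫⁻ x, min (-w x).toENNReal k ∂ν : ENNReal) : EReal) := fun k => by
    have h1 := h (-(k : ℝ)) (by simp)
    rw [← EReal.coe_le_coe_iff, EReal.coe_trunc _ ht,
      coe_integral_trunc hw hB (by simp : -(k : ℝ) ≤ 0)] at h1
    simpa using (le_max_left _ _).trans h1
  have hmono : Tendsto (fun k : ℕ => ∫⁻ x, min (-w x).toENNReal k ∂ν) atTop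
      (𝓝 (∫⁻ x, (-w x).toENNReal ∂ν)) := by
    refine lintegral_tendsto_of_tendsto_of_monotone
      (fun k => ((hw.neg.ereal_toENNReal).min measurable_const).aemeasurable)
      (Eventually.of_forall fun x k l hkl => ?_) (Eventually.of_forall fun x => ?_)
    · have : (k : ENNReal) ≤ l := by exact_mod_cast hkl
      exact min_le_min_left _ this
    · have h1 : Tendsto (fun k : ℕ => min (-w x).toENNReal (k : ENNReal)) atTop
          (𝓝 (min (-w x).toENNReal ⊤)) :=
        tendsto_const_nhds.min ENNReal.tendsto_nat_nhds_top
      simpa using h1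
  have hlim : Tendsto (fun k : ℕ => ((∫⁻ x, (w x).toENNReal ∂ν : ENNReal) : EReal) -
      ((∫⁻ x, min (-w x).toENNReal k ∂ν : ENNReal) : EReal)) atTop
      (𝓝 (((∫⁻ x, (w x).toENNReal ∂ν : ENNReal) : EReal) -
        ((∫⁻ x, (-w x).toENNReal ∂ν : ENNReal) : EReal))) := by
    have h1 := ((continuous_coe_ennreal_ereal.tendsto _).comp hmono).neg
    have h2 := EReal.continuousAt_add (p := (((∫⁻ x, (w x).toENNReal ∂ν : ENNReal) : EReal),
        -((∫⁻ x, (-w x).toENNReal ∂ν : ENNReal) : EReal)))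
        (Or.inl (by simpa using hP)) (Or.inl (by simp))
    exact h2.tendsto.comp (tendsto_const_nhds.prodMk_nhds h1)
  exact ge_of_tendsto' hlim hk

end Truncation

/-! ### Plurisubharmonic functions through their truncations. -/

section Psh

open Metric Filter Topology Real MeasureTheory

variable {m : ℕ}

lemma CP.circleMean_eq (u : (Fin m → ℂ) → EReal) (a b : Fin m → ℂ) :
    CP.circleMean u a b =
      ((laverage (volume.restrict (Set.Ioc 0 (2 * π))) fun θ => (u (a + circleMap 0 1 θ • b)).toENNReal : ENNReal) : EReal) -
      ((laverage (volume.restrict (Set.Ioc 0 (2 * π))) fun θ => (-u (a + circleMap 0 1 θ • b)).toENNReal : ENNReal) : EReal) := by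
  simp only [CP.circleMean, circleMap, Complex.ofReal_one, one_mul, zero_add]

/-- This is the normalized measure behind `laverage`, to which the truncation lemmas apply. -/
instance isProbabilityMeasure_Ioc_two_pi : IsProbabilityMeasure
    (((volume.restrict (Set.Ioc 0 (2 * π))) Set.univ)⁻¹ • volume.restrict (Set.Ioc 0 (2 * π))) := by
  constructor
  rw [Measure.smul_apply, smul_eq_mul]
  refine ENNReal.inv_mul_cancel ?_ ?_
  · simp [Real.pi_pos]
  · simpa using ENNReal.mul_ne_top ENNReal.ofNat_ne_top ENNReal.ofReal_ne_top

lemma circleAverage_eq_integral_smul (f : ℂ → ℝ) :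
    circleAverage f 0 1 = ∫ θ, f (circleMap 0 1 θ)
      ∂(((volume.restrict (Set.Ioc 0 (2 * π))) Set.univ)⁻¹ •
        volume.restrict (Set.Ioc 0 (2 * π))) := by
  rw [circleAverage_eq_intervalAverage, Set.uIoc_of_le two_pi_pos.le]
  rfl

lemma exists_forall_circle_le {u : (Fin m → ℂ) → EReal} (hu : UpperSemicontinuous u)
    (hlt : ∀ x, u x < ⊤) (a b : Fin m → ℂ) :
    ∃ B : ℝ, ∀ θ, u (a + circleMap 0 1 θ • b) ≤ B := by
  have hcont : Continuous fun ζ : ℂ => a + ζ • b := by fun_prop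
  obtain ⟨z, -, hz⟩ := (((hu.comp hcont).upperSemicontinuousOn (sphere 0 1))).exists_isMaxOn
    (NormedSpace.sphere_nonempty.2 zero_le_one) (isCompact_sphere 0 1)
  refine ⟨(u (a + z • b)).trunc 0, fun θ => ?_⟩
  rw [EReal.coe_trunc 0 (hlt _)]
  exact (hz (circleMap_mem_sphere 0 zero_le_one θ)).trans (le_max_left _ _)

/-- The sub-mean value inequality for functions with values in `[-∞, ∞)` in terms of the
truncations of the function. -/
lemma CP.isPsh_of_trunc {u : (Fin m → ℂ) → EReal} (hlt : ∀ x, u x < ⊤)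
    (hu : UpperSemicontinuous u)
    (h : ∀ s ≤ 0, ∀ a b, (u a).trunc s ≤ circleAverage (fun ζ => (u (a + ζ • b)).trunc s) 0 1) :
    CP.IsPsh u := by
  refine ⟨hlt, hu, fun a b => ?_⟩
  obtain ⟨B, hB⟩ := exists_forall_circle_le hu hlt a b
  rw [CP.circleMean_eq]
  have hmeas : Measurable fun θ => u (a + circleMap 0 1 θ • b) :=
    (hu.comp (by fun_prop : Continuous fun θ => a + circleMap 0 1 θ • b)).measurable
  refine le_sub_of_integral_trunc_le hmeas (Eventually.of_forall hB) (hlt a) fun s hs => ?_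
  have := h s hs a b
  rwa [circleAverage_eq_integral_smul] at this

lemma IsRealPsh.circleIntegrable {U : (Fin m → ℂ) → ℝ} (hU : IsRealPsh U) (a b : Fin m → ℂ) :
    CircleIntegrable (fun ζ => U (a + ζ • b)) 0 1 := by
  obtain ⟨N, hN⟩ := hU.bddBelow
  exact circleIntegrable_of_upperSemicontinuousOn ((hU.usc.comp
    (by fun_prop : Continuous fun ζ : ℂ => a + ζ • b)).upperSemicontinuousOn _) (fun _ _ => hN _)

lemma IsRealPsh.max_const {U : (Fin m → ℂ) → ℝ} (hU : IsRealPsh U) (s : ℝ) :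
    IsRealPsh fun x => max (U x) s := by
  have husc : UpperSemicontinuous fun x => max (U x) s := hU.usc.sup upperSemicontinuous_const
  refine ⟨husc, ⟨s, fun x => le_max_right _ _⟩, fun a b => ?_⟩
  have hi : CircleIntegrable (fun ζ => max (U (a + ζ • b)) s) 0 1 :=
    circleIntegrable_of_upperSemicontinuousOn (N := s) ((husc.comp
      (by fun_prop : Continuous fun ζ : ℂ => a + ζ • b)).upperSemicontinuousOn _)
      (fun _ _ => le_max_right _ _)
  refine max_le ((hU.submean a b).trans ?_) ?_
  · exact circleAverage_mono (hU.circleIntegrable a b) hi fun _ _ => le_max_left _ _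
  · calc s = circleAverage (fun _ => s) (0 : ℂ) 1 := (circleAverage_const s (0 : ℂ) 1).symm
      _ ≤ _ := circleAverage_mono (circleIntegrable_const _ _ _) hi fun _ _ => le_max_right _ _

lemma CP.IsPsh.isRealPsh_trunc {u : (Fin m → ℂ) → EReal} (hu : CP.IsPsh u) (s : ℝ) :
    IsRealPsh fun x => (u x).trunc s := by
  have key : ∀ s ≤ 0, IsRealPsh fun x => (u x).trunc s := fun s hs => by
    refine ⟨upperSemicontinuous_trunc hu.usc hu.lt_top s,
      ⟨s, fun x => EReal.le_trunc s (hu.lt_top x)⟩, fun a b => ?_⟩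
    obtain ⟨B, hB⟩ := exists_forall_circle_le hu.usc hu.lt_top a b
    have hmeas : Measurable fun θ => u (a + circleMap 0 1 θ • b) :=
      (hu.usc.comp (by fun_prop : Continuous fun θ => a + circleMap 0 1 θ • b)).measurable
    have h1 := hu.submean a b
    rw [CP.circleMean_eq] at h1
    rw [circleAverage_eq_integral_smul]
    exact integral_trunc_le_of_le_sub hmeas (Eventually.of_forall hB) hs (hu.lt_top a) h1
  -- A positive level is reached by truncating at `0` and then taking a maximum.
  have e : (fun x => (u x).trunc s) = fun x => max ((u x).trunc (min s 0)) s :=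
    funext fun x => EReal.trunc_eq_max (min_le_left _ _) (hu.lt_top x)
  rw [e]
  exact (key _ (min_le_right _ _)).max_const s

lemma EReal.continuous_coe_mul_add_coe {c : ℝ} (hc : 0 < c) (d : ℝ) :
    Continuous fun x : EReal => c * x + d := by
  rw [continuous_iff_continuousAt]
  intro x
  have hc' : (c : EReal) ≠ 0 := by exact_mod_cast hc.ne'
  have h1 : ContinuousAt (fun x : EReal => (c : EReal) * x) x :=
    ContinuousAt.comp (g := fun p : EReal × EReal => p.1 * p.2) (f := fun x => ((c : EReal), x))
      (EReal.continuousAt_mul (Or.inl hc') (Or.inl hc') (Or.inl (by simp)) (Or.inl (by simp)))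
      (by fun_prop)
  exact ContinuousAt.comp (g := fun p : EReal × EReal => p.1 + p.2)
    (f := fun x => ((c : EReal) * x, (d : EReal)))
    (EReal.continuousAt_add (Or.inr (by simp)) (Or.inr (by simp))) (h1.prodMk continuousAt_const)

lemma EReal.monotone_coe_mul_add_coe {c : ℝ} (hc : 0 < c) (d : ℝ) :
    Monotone fun x : EReal => c * x + d := fun x y hxy => by
  have : (0 : EReal) ≤ c := by exact_mod_cast hc.le
  simp only
  gcongr

lemma EReal.coe_mul_add_coe_lt_top {c : ℝ} (hc : 0 < c) (d : ℝ) {x : EReal} (hx : x < ⊤) :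
    c * x + d < ⊤ := by
  induction x with
  | bot => rw [EReal.coe_mul_bot_of_pos hc, EReal.bot_add]; exact bot_lt_top
  | coe r => exact_mod_cast EReal.coe_lt_top (c * r + d)
  | top => exact absurd hx (lt_irrefl _)

lemma CP.IsPsh.const_mul_add {u : (Fin m → ℂ) → EReal} (hu : CP.IsPsh u) {c : ℝ} (hc : 0 < c)
    (d : ℝ) : CP.IsPsh fun x => c * u x + d := by
  refine CP.isPsh_of_trunc (fun x => EReal.coe_mul_add_coe_lt_top hc d (hu.lt_top x)) ?_ ?_
  · exact (EReal.continuous_coe_mul_add_coe hc d).comp_upperSemicontinuous hu.usc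
      (EReal.monotone_coe_mul_add_coe hc d)
  · intro s _ a b
    simp only [EReal.trunc_mul_add_coe hc (hu.lt_top _)]
    have hU := hu.isRealPsh_trunc ((s - d) / c)
    have h1 := hU.submean a b
    have hi := hU.circleIntegrable a b
    have hi' : CircleIntegrable (fun ζ => c * (u (a + ζ • b)).trunc ((s - d) / c)) 0 1 :=
      hi.const_smul (a := c)
    have e := circleAverage_fun_smul (a := c)
      (f := fun ζ => (u (a + ζ • b)).trunc ((s - d) / c)) (c := 0) (R := 1)
    simp only [smul_eq_mul] at e
    rw [circleAverage_fun_add hi' (circleIntegrable_const _ _ _), circleAverage_const, e]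
    gcongr

end Psh

/-! ### Surjectivity of endomorphisms by dimension theory. -/

section Surjectivity

open MvPolynomial

lemma MvPolynomial.IsHomogeneous.eval_smul_eq {σ R : Type*} [CommSemiring R]
    {F : MvPolynomial σ R} {d : ℕ} (hF : F.IsHomogeneous d) (c : R) (z : σ → R) :
    eval (c • z) F = c ^ d * eval z F := by
  classical
  rw [eval_eq, eval_eq, Finset.mul_sum]
  refine Finset.sum_congr rfl fun e he => ?_
  have h1 : ∑ i ∈ e.support, e i = d := by
    have := hF (mem_support_iff.1 he)
    rwa [Finsupp.weight_apply, Finsupp.sum, Finset.sum_congr rfl fun _ _ => by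
      rw [Pi.one_apply, smul_eq_mul, mul_one]] at this
  simp only [Pi.smul_apply, smul_eq_mul, mul_pow, Finset.prod_mul_distrib]
  rw [Finset.prod_pow_eq_pow_sum, h1]
  ring

/-- Translation of the variables as an automorphism of a polynomial ring. -/
noncomputable def MvPolynomial.translate {σ R : Type*} [CommRing R] (x : σ → R) :
    MvPolynomial σ R ≃ₐ[R] MvPolynomial σ R :=
  AlgEquiv.ofAlgHom (aeval fun i => X i + C (x i)) (aeval fun i => X i - C (x i))
    (by ext i; simp [← algebraMap_eq]) (by ext i; simp [← algebraMap_eq])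

lemma MvPolynomial.eval_zero_translate {σ R : Type*} [CommRing R] (x : σ → R)
    (p : MvPolynomial σ R) : eval 0 (translate x p) = eval x p := by
  have h : (aeval (0 : σ → R)).comp (translate x).toAlgHom = aeval x := by
    ext i
    simp [translate]
  simpa [coe_aeval_eq_eval] using DFunLike.congr_fun h p

/-- By the Nullstellensatz every maximal ideal belongs to a point, and translations carry it to the
one at the origin. All have the same height, and the supremum of these heights is the dimension `n`.
-/
lemma MvPolynomial.le_height_vanishingIdeal_zero {k : Type*} [Field k] [IsAlgClosed k] (n : ℕ) :
    (n : ℕ∞) ≤ (vanishingIdeal k {(0 : Fin n → k)}).height := by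
  have h1 : ∀ I : Ideal (MvPolynomial (Fin n) k), I.IsMaximal →
      I.height = (vanishingIdeal k {(0 : Fin n → k)}).height := fun I hI => by
    obtain ⟨x, rfl⟩ := eq_vanishingIdeal_singleton_of_isMaximal k hI
    rw [← RingEquiv.height_comap (translate x).toRingEquiv (vanishingIdeal k {0})]
    congr 1
    ext p
    rw [Ideal.mem_comap, mem_vanishingIdeal_singleton_iff, mem_vanishingIdeal_singleton_iff]
    change eval x p = 0 ↔ eval 0 (translate x p) = 0
    rw [eval_zero_translate]
  have h2 := Ideal.sup_isMaximal_height_eq_ringKrullDim (R := MvPolynomial (Fin n) k)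
  rw [MvPolynomial.ringKrullDim_of_isNoetherianRing, ringKrullDim_eq_zero_of_field] at h2
  have h3 : (⨆ (I : Ideal (MvPolynomial (Fin n) k)) (_ : I.IsMaximal), I.height) ≤
      (vanishingIdeal k {(0 : Fin n → k)}).height :=
    iSup₂_le fun I hI => (h1 I hI).le
  have h4 : ((n : ℕ∞) : WithBot ℕ∞) = ((⨆ (I : Ideal (MvPolynomial (Fin n) k))
      (_ : I.IsMaximal), I.height : ℕ∞) : WithBot ℕ∞) := by
    rw [h2]; simp
  rw [WithBot.coe_inj] at h4
  rwa [h4]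

/-- Fewer forms of positive degree than variables have a nontrivial common zero. -/
theorem MvPolynomial.exists_ne_zero_forall_eval_eq_zero {k : Type*} [Field k] [IsAlgClosed k]
    {n : ℕ} (G : Fin n → MvPolynomial (Fin (n + 1)) k) {d : ℕ} (hd : d ≠ 0)
    (hG : ∀ l, (G l).IsHomogeneous d) : ∃ z ≠ 0, ∀ l, eval z (G l) = 0 := by
  by_contra! hne
  set I := Ideal.span (Set.range G)
  have h0 : ∀ l, eval 0 (G l) = 0 := fun l => by
    have := (hG l).eval_smul_eq 0 0
    simpa [hd] using this
  have hle : I ≤ vanishingIdeal k {(0 : Fin (n + 1) → k)} := by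
    rw [Ideal.span_le]
    rintro _ ⟨l, rfl⟩
    simpa [coe_aeval_eq_eval] using h0 l
  have hzl : zeroLocus k I = {0} := by
    ext z
    rw [zeroLocus_span, Set.mem_singleton_iff]
    constructor
    · intro hz
      by_contra hz0
      obtain ⟨l, hl⟩ := hne z hz0
      exact hl (by simpa [coe_aeval_eq_eval] using hz (G l) ⟨l, rfl⟩)
    · rintro rfl _ ⟨l, rfl⟩
      simpa [coe_aeval_eq_eval] using h0 l
  -- If the origin is the only zero, its maximal ideal is minimal over an ideal with `n` generators,
  -- so Krull bounds its height by `n`, against the lower bound `n + 1`.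
  have hrad : I.radical = vanishingIdeal k {(0 : Fin (n + 1) → k)} := by
    rw [← vanishingIdeal_zeroLocus_eq_radical (K := k), hzl]
  have hmax : (vanishingIdeal k {(0 : Fin (n + 1) → k)}).IsMaximal :=
    isMaximal_iff_eq_vanishingIdeal_singleton.2 ⟨0, rfl⟩
  have hmin : vanishingIdeal k {(0 : Fin (n + 1) → k)} ∈ I.minimalPrimes := by
    refine ⟨⟨hmax.isPrime, hle⟩, fun J hJ _ => ?_⟩
    rw [← hrad]
    exact hJ.1.radical_le_iff.2 hJ.2
  have h1 := Ideal.height_le_card_of_mem_minimalPrimes_span (Set.finite_range G) hmin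
  have h2 := (le_height_vanishingIdeal_zero (k := k) (n + 1)).trans h1
  have h3 : (Set.range G).ncard ≤ n := by
    rw [← Set.image_univ]
    exact (Set.ncard_image_le Set.finite_univ).trans (by simp)
  have h4 : n + 1 ≤ (Set.range G).ncard := by exact_mod_cast h2
  omega

/-- A self-map of projective space given by forms of positive degree without nontrivial common
zeros is surjective. -/
theorem CP.IsGivenByDegree.surjective {n : ℕ} {f : CP n → CP n} {d : ℕ}
    (hf : CP.IsGivenByDegree f d) (hd : d ≠ 0) : Function.Surjective f := by
  obtain ⟨F, hF, hF0, hfF⟩ := hf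
  intro y
  induction y using Projectivization.ind with
  | h y hy =>
  obtain ⟨k, hk⟩ := Function.ne_iff.1 hy
  -- Since `y k ≠ 0`, these `n` forms vanish at `z` exactly when `F z` is proportional to `y`.
  obtain ⟨z, hz, hGz⟩ := exists_ne_zero_forall_eval_eq_zero
    (fun l => C (y k) * F (k.succAbove l) - C (y (k.succAbove l)) * F k) hd
    (fun l => (by simpa using (isHomogeneous_C _ (y k)).mul (hF (k.succAbove l)) :
        (C (y k) * F (k.succAbove l)).IsHomogeneous d).sub
      (by simpa using (isHomogeneous_C _ (y (k.succAbove l))).mul (hF k) :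
        (C (y (k.succAbove l)) * F k).IsHomogeneous d))
  refine ⟨Projectivization.mk ℂ z hz, ?_⟩
  rw [hfF, Projectivization.mk_eq_mk_iff']
  refine ⟨eval z (F k) / y k, ?_⟩
  have hk : y k ≠ 0 := hk
  funext i
  rw [Pi.smul_apply, smul_eq_mul]
  rcases Fin.eq_self_or_eq_succAbove k i with rfl | ⟨l, rfl⟩
  · field_simp
  · have := hGz l
    simp only [map_sub, map_mul, eval_C, sub_eq_zero] at this
    field_simp
    rw [this]; ring

end Surjectivity

/-! ### Homogeneous coordinates, pullback and capacity. -/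

namespace CP

open Metric Filter Topology Real MvPolynomial

/-- The logarithm of the Euclidean norm on `ℂⁿ⁺¹`. -/
noncomputable def logNorm {n : ℕ} (z : Fin n → ℂ) : ℝ := Real.log (∑ k, ‖z k‖ ^ 2) / 2

lemma sum_norm_sq_pos {n : ℕ} {z : Fin n → ℂ} (hz : z ≠ 0) : 0 < ∑ k, ‖z k‖ ^ 2 := by
  obtain ⟨k, hk⟩ := Function.ne_iff.1 hz
  refine Finset.sum_pos' (fun _ _ => by positivity) ⟨k, Finset.mem_univ k, ?_⟩
  have : 0 < ‖z k‖ := norm_pos_iff.2 hk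
  positivity

lemma logNorm_smul {n : ℕ} {c : ℂ} (hc : c ≠ 0) {z : Fin n → ℂ} (hz : z ≠ 0) :
    logNorm (c • z) = Real.log ‖c‖ + logNorm z := by
  have h1 : ∑ k, ‖(c • z) k‖ ^ 2 = ‖c‖ ^ 2 * ∑ k, ‖z k‖ ^ 2 := by
    rw [Finset.mul_sum]
    exact Finset.sum_congr rfl fun k _ => by rw [Pi.smul_apply, smul_eq_mul, norm_mul, mul_pow]
  have h2 : ‖c‖ ^ 2 ≠ 0 := pow_ne_zero _ (norm_ne_zero_iff.2 hc)
  rw [logNorm, logNorm, h1, Real.log_mul h2 (sum_norm_sq_pos hz).ne', Real.log_pow]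
  push_cast
  ring

lemma logNorm_insertNth {n : ℕ} (i : Fin (n + 1)) (w : Fin n → ℂ) :
    logNorm (i.insertNth (α := fun _ => ℂ) 1 w : Fin (n + 1) → ℂ) = fsPotential w := by
  rw [logNorm, fsPotential, Fin.sum_univ_succAbove _ i]
  simp

lemma continuousOn_logNorm {n : ℕ} : ContinuousOn (logNorm (n := n)) {z | z ≠ 0} := by
  refine ContinuousOn.div_const (ContinuousOn.log ?_ fun z hz => (sum_norm_sq_pos hz).ne') _
  fun_prop

lemma insertNth_div {n : ℕ} (k : Fin (n + 1)) {z : Fin (n + 1) → ℂ} (hk : z k ≠ 0) :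
    z k • (k.insertNth (α := fun _ => ℂ) 1 (fun l => z (k.succAbove l) / z k) :
      Fin (n + 1) → ℂ) = z := by
  funext i
  rcases Fin.eq_self_or_eq_succAbove k i with rfl | ⟨l, rfl⟩
  · simp
  · simp [mul_div_cancel₀ _ hk]

lemma mk_eq_affineEmb {n : ℕ} (k : Fin (n + 1)) {z : Fin (n + 1) → ℂ} (hz : z ≠ 0)
    (hk : z k ≠ 0) :
    Projectivization.mk ℂ z hz = affineEmb k (fun l => z (k.succAbove l) / z k) := by
  rw [affineEmb, Projectivization.mk_eq_mk_iff']
  exact ⟨z k, insertNth_div k hk⟩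

/-- The global potential `log |z|` and the potential of a chart differ by `log |z k|`, which is
harmonic along holomorphic curves avoiding `z k = 0`. -/
lemma logNorm_eq_fsPotential_add {n : ℕ} (k : Fin (n + 1)) {z : Fin (n + 1) → ℂ}
    (hk : z k ≠ 0) :
    logNorm z = fsPotential (fun l => z (k.succAbove l) / z k) + Real.log ‖z k‖ := by
  have h := logNorm_smul hk (insertNth_one_ne_zero k fun l => z (k.succAbove l) / z k)
  rw [insertNth_div k hk, logNorm_insertNth] at h
  rw [h, add_comm (Real.log _)]

lemma continuous_mk_comp {X : Type*} [TopologicalSpace X] {n : ℕ} {p : X → Fin (n + 1) → ℂ}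
    (hp : Continuous p) (h0 : ∀ x, p x ≠ 0) :
    Continuous fun x => (Projectivization.mk ℂ (p x) (h0 x) : CP n) := by
  have h1 : Continuous (Projectivization.mk' ℂ : {v : Fin (n + 1) → ℂ // v ≠ 0} → CP n) :=
    continuous_coinduced_rng
  exact h1.comp (hp.subtype_mk h0)

lemma IsOmegaPsh.lt_top {n : ℕ} {φ : CP n → EReal} (hφ : IsOmegaPsh φ) (x : CP n) : φ x < ⊤ := by
  induction x using Projectivization.ind with
  | h z hz =>
  obtain ⟨k, hk⟩ := Function.ne_iff.1 hz
  have h1 := (hφ.psh k).lt_top (fun l => z (k.succAbove l) / z k)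
  rw [← mk_eq_affineEmb k hz hk] at h1
  refine lt_top_iff_ne_top.2 fun h => ?_
  rw [h, EReal.top_add_coe] at h1
  exact lt_irrefl _ h1

/-- In homogeneous coordinates an `ω`-plurisubharmonic function gives a function which is
plurisubharmonic along all holomorphic maps. -/
theorem IsOmegaPsh.isPsh_comp {n m : ℕ} {φ : CP n → EReal} (hφ : IsOmegaPsh φ)
    {p : (Fin m → ℂ) → Fin (n + 1) → ℂ} (hp : Differentiable ℂ p) (h0 : ∀ w, p w ≠ 0) :
    IsPsh fun w => φ (Projectivization.mk ℂ (p w) (h0 w)) + (logNorm (p w) : EReal) := by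
  have hcont : Continuous fun w => logNorm (p w) :=
    continuousOn_logNorm.comp_continuous hp.continuous h0
  have hlt : ∀ w, φ (Projectivization.mk ℂ (p w) (h0 w)) + (logNorm (p w) : EReal) < ⊤ := fun w =>
    EReal.add_lt_top (hφ.lt_top _).ne (EReal.coe_ne_top _)
  have husc : UpperSemicontinuous fun w =>
      φ (Projectivization.mk ℂ (p w) (h0 w)) + (logNorm (p w) : EReal) :=
    (hφ.usc.comp (continuous_mk_comp hp.continuous h0)).add'
      (continuous_coe_real_ereal.comp hcont).upperSemicontinuous
      fun w => EReal.continuousAt_add (Or.inr (by simp)) (Or.inr (by simp))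
  refine isPsh_of_trunc hlt husc fun s hs a b => ?_
  have hline : Differentiable ℂ fun ζ : ℂ => a + ζ • b := by fun_prop
  have hpl : Differentiable ℂ fun ζ : ℂ => p (a + ζ • b) := hp.comp hline
  set v : ℂ → EReal := fun ζ =>
    φ (Projectivization.mk ℂ (p (a + ζ • b)) (h0 _)) + (logNorm (p (a + ζ • b)) : EReal) with hv
  have hvusc : UpperSemicontinuous fun ζ => (v ζ).trunc s :=
    upperSemicontinuous_trunc (husc.comp hline.continuous) (fun _ => hlt _) s
  have hvlt : ∀ ζ, v ζ < ⊤ := fun ζ => hlt _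
  have hvint : ∀ z r, CircleIntegrable (fun ζ => (v ζ).trunc s) z r := fun z r =>
    circleIntegrable_of_upperSemicontinuousOn (N := s) (hvusc.upperSemicontinuousOn _)
      fun ζ _ => EReal.le_trunc s (hvlt ζ)
  -- No single chart need contain the whole disc; the asymptotic criterion allows a chart chosen for
  -- each point `z`.
  suffices h : AsymptoticSubmeanOn (fun ζ => (v ζ).trunc s) 0 1 by
    simpa [hv] using h.le_circleAverage one_pos
  refine ⟨hvusc.upperSemicontinuousOn _, ⟨s, fun ζ _ => EReal.le_trunc s (hvlt ζ)⟩, ?_⟩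
  intro z _ δ hδ
  obtain ⟨k, hk⟩ := Function.ne_iff.1 (h0 (a + z • b))
  have hdiff : ∀ i, Differentiable ℂ fun ζ : ℂ => p (a + ζ • b) i := differentiable_pi.1 hpl
  set O : Set ℂ := {ζ | p (a + ζ • b) k ≠ 0} with hOdef
  have hO : IsOpen O := isOpen_ne_fun (hdiff k).continuous continuous_const
  set q : ℂ → Fin n → ℂ := fun ζ l => p (a + ζ • b) (k.succAbove l) / p (a + ζ • b) k with hq
  have hqd : DifferentiableOn ℂ q O := differentiableOn_pi.2 fun l =>
    ((hdiff (k.succAbove l)).differentiableOn).div (hdiff k).differentiableOn fun ζ hζ => hζ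
  obtain ⟨ρ, hρ, hρO⟩ := nhds_basis_closedBall.mem_iff.1 (hO.mem_nhds hk)
  have hlogc : ContinuousOn (fun ζ => Real.log ‖p (a + ζ • b) k‖) (closedBall z ρ) :=
    ContinuousOn.log (hdiff k).continuous.norm.continuousOn
      fun ζ hζ => norm_ne_zero_iff.2 (hρO hζ)
  obtain ⟨C, hC⟩ := (isCompact_closedBall z ρ).bddAbove_image hlogc
  have hC : ∀ ζ ∈ closedBall z ρ, Real.log ‖p (a + ζ • b) k‖ ≤ C := fun ζ hζ =>
    hC (Set.mem_image_of_mem _ hζ)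
  -- With `log ‖p k‖ ≤ C` nearby, truncating at `s - C` in the chart is invisible after truncating
  -- `v` at `s`.
  have hU := (hφ.psh k).isRealPsh_trunc (s - C)
  set U : (Fin n → ℂ) → ℝ := fun w => (φ (affineEmb k w) + (fsPotential w : EReal)).trunc (s - C)
    with hUdef
  have hloc : ∀ ζ ∈ closedBall z ρ, (v ζ).trunc s =
      max (U (q ζ) + Real.log ‖p (a + ζ • b) k‖) s := fun ζ hζ => by
    have h1 : v ζ = (φ (affineEmb k (q ζ)) + (fsPotential (q ζ) : EReal))
        + (Real.log ‖p (a + ζ • b) k‖ : EReal) := by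
      rw [add_assoc, ← EReal.coe_add, ← logNorm_eq_fsPotential_add k (hρO hζ),
        ← mk_eq_affineEmb k (h0 _) (hρO hζ)]
    rw [h1, EReal.trunc_add_coe (s' := s - C) (by linarith [hC ζ hζ]) ((hφ.psh k).lt_top _)]
  filter_upwards [Ioo_mem_nhdsGT hρ] with r hr
  have hr0 : 0 < r := hr.1
  have hsub : closedBall z r ⊆ closedBall z ρ := closedBall_subset_closedBall hr.2.le
  have hsph : sphere z |r| ⊆ closedBall z ρ := by
    rw [abs_of_pos hr0]; exact sphere_subset_closedBall.trans hsub
  have hqc : ContinuousOn q (sphere z |r|) := hqd.continuousOn.mono (hsph.trans hρO)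
  have i1 : CircleIntegrable (U ∘ q) z r := by
    obtain ⟨N, hN⟩ := hU.bddBelow
    exact circleIntegrable_of_upperSemicontinuousOn
      ((hU.usc.upperSemicontinuousOn Set.univ).comp hqc (Set.mapsTo_univ _ _)) fun _ _ => hN _
  have i2 : CircleIntegrable (fun ζ => Real.log ‖p (a + ζ • b) k‖) z r :=
    (hlogc.mono hsph).circleIntegrable'
  have m1 : U (q z) ≤ circleAverage (U ∘ q) z r :=
    hU.le_circleAverage_comp hO hqd hr0 (hsub.trans hρO)
  have m2 : circleAverage (fun ζ => Real.log ‖p (a + ζ • b) k‖) z r =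
      Real.log ‖p (a + z • b) k‖ := by
    refine AnalyticOnNhd.circleAverage_log_norm_of_ne_zero (g := fun ζ => p (a + ζ • b) k)
      (fun ζ _ => (hdiff k).analyticAt ζ) fun ζ hζ => ?_
    rw [abs_of_pos hr0] at hζ
    exact hρO (hsub hζ)
  have m3 : circleAverage (fun ζ => (U ∘ q) ζ + Real.log ‖p (a + ζ • b) k‖) z r ≤
      circleAverage (fun ζ => (v ζ).trunc s) z r :=
    circleAverage_mono (i1.add i2) (hvint z r) fun ζ hζ => by
      rw [hloc ζ (hsph hζ)]
      exact le_max_left _ _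
  have m4 : s ≤ circleAverage (fun ζ => (v ζ).trunc s) z r :=
    calc s = circleAverage (fun _ => s) z r := (circleAverage_const s z r).symm
      _ ≤ _ := circleAverage_mono (circleIntegrable_const _ _ _) (hvint z r)
        fun ζ _ => EReal.le_trunc s (hvlt ζ)
  rw [circleAverage_fun_add i1 i2, m2] at m3
  have m5 : (v z).trunc s ≤ circleAverage (fun ζ => (v ζ).trunc s) z r := by
    rw [hloc z (mem_closedBall_self hρ.le)]
    exact max_le (by linarith) m4
  have : 0 ≤ δ * r ^ 2 := by positivity
  linarith

/-- A homogeneous polynomial map of degree `d` without nontrivial zeros changes `log |z|` into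
`d log |z|`, up to a bounded function. -/
lemma exists_abs_logNorm_sub_le {n d : ℕ} {F : Fin (n + 1) → MvPolynomial (Fin (n + 1)) ℂ}
    (hF : ∀ i, (F i).IsHomogeneous d)
    (hF0 : ∀ z : Fin (n + 1) → ℂ, z ≠ 0 → (fun i => eval z (F i)) ≠ 0) :
    (∀ c : ℂ, c ≠ 0 → ∀ z : Fin (n + 1) → ℂ, z ≠ 0 →
      logNorm (fun i => eval (c • z) (F i)) - d * logNorm (c • z) =
        logNorm (fun i => eval z (F i)) - d * logNorm z) ∧
    ContinuousOn (fun z : Fin (n + 1) → ℂ => logNorm (fun i => eval z (F i)) - d * logNorm z)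
      {z | z ≠ 0} ∧
    ∃ C, ∀ z : Fin (n + 1) → ℂ, z ≠ 0 →
      |logNorm (fun i => eval z (F i)) - d * logNorm z| ≤ C := by
  have hinv : ∀ c : ℂ, c ≠ 0 → ∀ z : Fin (n + 1) → ℂ, z ≠ 0 →
      logNorm (fun i => eval (c • z) (F i)) - d * logNorm (c • z) =
        logNorm (fun i => eval z (F i)) - d * logNorm z := fun c hc z hz => by
    have h1 : (fun i => eval (c • z) (F i)) = c ^ d • fun i => eval z (F i) := by
      funext i
      rw [(hF i).eval_smul_eq, Pi.smul_apply, smul_eq_mul]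
    rw [h1, logNorm_smul (pow_ne_zero _ hc) (hF0 z hz), logNorm_smul hc hz, norm_pow, Real.log_pow]
    ring
  have hcont : ContinuousOn (fun z : Fin (n + 1) → ℂ =>
      logNorm (fun i => eval z (F i)) - d * logNorm z) {z | z ≠ 0} := by
    refine ContinuousOn.sub ?_ (continuousOn_const.mul continuousOn_logNorm)
    refine continuousOn_logNorm.comp (f := fun z : Fin (n + 1) → ℂ => fun i => eval z (F i)) ?_
      fun z hz => hF0 z hz
    exact (continuous_pi fun i => (F i).continuous_eval).continuousOn
  refine ⟨hinv, hcont, ?_⟩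
  -- Scale invariance reduces the bound to the unit sphere.
  obtain ⟨C, hC⟩ := (isCompact_sphere (0 : Fin (n + 1) → ℂ) 1).exists_bound_of_continuousOn
    (hcont.mono fun z hz => by rintro rfl; simp at hz)
  refine ⟨C, fun z hz => ?_⟩
  have hn : (‖z‖ : ℂ) ≠ 0 := by exact_mod_cast norm_ne_zero_iff.2 hz
  rw [← hinv _ (inv_ne_zero hn) z hz]
  exact hC _ (by simp [norm_smul, norm_ne_zero_iff.2 hz])

/-- Pulling back `ω`-plurisubharmonic functions by an endomorphism of degree `d`. -/
theorem IsGivenByDegree.exists_pullback {n d : ℕ} {f : CP n → CP n} (hf : IsGivenByDegree f d)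
    (hcont : Continuous f) (hd : d ≠ 0) :
    ∃ C : ℝ, ∃ g : CP n → ℝ, (∀ x, |g x| ≤ C) ∧ ∀ φ : CP n → EReal, IsOmegaPsh φ → ∀ e : ℝ,
      IsOmegaPsh fun x => (((d : ℝ)⁻¹ : ℝ) : EReal) * φ (f x) + ((g x + e : ℝ) : EReal) := by
  have hsurj := hf.surjective hd
  obtain ⟨F, hF, hF0, hfF⟩ := hf
  obtain ⟨hinv, hhc, C, hC⟩ := exists_abs_logNorm_sub_le hF hF0
  have hd0 : (d : ℝ) ≠ 0 := by exact_mod_cast hd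
  have hdpos : (0 : ℝ) < (d : ℝ)⁻¹ := by positivity
  -- The potential of `d⁻¹ f^*ω - ω`; by scale invariance the choice of representative is
  -- irrelevant.
  let g : CP n → ℝ := fun x =>
    (d : ℝ)⁻¹ * (logNorm (fun i => eval x.rep (F i)) - d * logNorm x.rep)
  have hgmk : ∀ (z : Fin (n + 1) → ℂ) (hz : z ≠ 0), g (Projectivization.mk ℂ z hz) =
      (d : ℝ)⁻¹ * (logNorm (fun i => eval z (F i)) - d * logNorm z) := fun z hz => by
    obtain ⟨c, hc⟩ := Projectivization.exists_smul_eq_mk_rep ℂ z hz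
    have hc' : (Projectivization.mk ℂ z hz).rep = (c : ℂ) • z := hc.symm
    simp only [g]
    rw [hc', hinv _ c.ne_zero z hz]
  have hgc : Continuous g := by
    rw [continuous_coinduced_dom]
    have h1 : Continuous fun v : {v : Fin (n + 1) → ℂ // v ≠ 0} =>
        (d : ℝ)⁻¹ * (logNorm (fun i => eval v.1 (F i)) - d * logNorm v.1) :=
      continuous_const.mul (hhc.comp_continuous continuous_subtype_val fun v => v.2)
    convert h1 using 2 with v
    exact hgmk v.1 v.2
  refine ⟨(d : ℝ)⁻¹ * C, g, fun x => ?_, fun φ hφ e => ⟨?_, ?_, fun i => ?_⟩⟩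
  · rw [abs_mul, abs_of_pos hdpos]
    exact mul_le_mul_of_nonneg_left (hC _ x.rep_nonzero) hdpos.le
  · have h1 : UpperSemicontinuous fun x => (((d : ℝ)⁻¹ : ℝ) : EReal) * φ (f x) := by
      have := (EReal.continuous_coe_mul_add_coe hdpos 0).comp_upperSemicontinuous
        (hφ.usc.comp hcont) (EReal.monotone_coe_mul_add_coe hdpos 0)
      simpa [Function.comp_def] using this
    exact h1.add' (continuous_coe_real_ereal.comp
      (hgc.add continuous_const)).upperSemicontinuous
      fun w => EReal.continuousAt_add (Or.inr (EReal.coe_ne_bot _)) (Or.inr (EReal.coe_ne_top _))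
  -- Surjectivity keeps the pullback from being identically `-∞`.
  · obtain ⟨y, hy⟩ := hφ.ne_bot
    obtain ⟨x, rfl⟩ := hsurj y
    refine ⟨x, ?_⟩
    lift φ (f x) to ℝ using ⟨(hφ.lt_top _).ne, hy⟩ with r
    rw [← EReal.coe_mul, ← EReal.coe_add]
    exact EReal.coe_ne_bot _
  · let P : (Fin n → ℂ) → Fin (n + 1) → ℂ := fun w j =>
      eval (i.insertNth (α := fun _ => ℂ) 1 w : Fin (n + 1) → ℂ) (F j)
    have hP0 : ∀ w, P w ≠ 0 := fun w => hF0 _ (insertNth_one_ne_zero i w)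
    have hins : Differentiable ℂ fun w : Fin n → ℂ =>
        (i.insertNth (α := fun _ => ℂ) 1 w : Fin (n + 1) → ℂ) := by
      refine differentiable_pi.2 fun j => ?_
      rcases Fin.eq_self_or_eq_succAbove i j with rfl | ⟨l, rfl⟩
      · simp
      · simpa using differentiable_apply l
    have hPd : Differentiable ℂ P := differentiable_pi.2 fun j => by
      have h1 : Differentiable ℂ fun z : Fin (n + 1) → ℂ => eval z (F j) := by
        simp only [MvPolynomial.eval_eq]
        fun_prop
      exact h1.comp hins
    -- In the chart, adding the potential to the pullback gives `d⁻¹ (φ [P] + log |P|) + e`: the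
    -- potential cancels the `-log |z|` in `g`.
    have h1 := (hφ.isPsh_comp hPd hP0).const_mul_add hdpos e
    convert h1 using 2 with w
    have h2 : f (affineEmb i w) = Projectivization.mk ℂ (P w) (hP0 w) := hfF _ _
    have h3 : g (affineEmb i w) = (d : ℝ)⁻¹ * logNorm (P w) - fsPotential w := by
      rw [affineEmb, hgmk, logNorm_insertNth]
      simp only [P]
      field_simp
    rw [h2, h3]
    have hlt := hφ.lt_top (Projectivization.mk ℂ (P w) (hP0 w))
    generalize φ (Projectivization.mk ℂ (P w) (hP0 w)) = t at hlt
    induction t with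
    | bot => simp [EReal.coe_mul_bot_of_pos hdpos]
    | coe r =>
      norm_cast
      ring
    | top => exact absurd hlt (lt_irrefl _)

/-- A limsup never exceeds the global supremum, and `nhds p` sees the value at `p` itself. -/
lemma iSup_extremalReg {n : ℕ} (K : Set (CP n)) :
    ⨆ p, extremalReg K p = ⨆ p, extremal K p := by
  refine le_antisymm (iSup_le fun p => ?_) (iSup_mono fun p => ?_)
  · exact limsup_le_of_le (by isBoundedDefault) (Eventually.of_forall fun q => le_iSup _ q)
  · refine le_limsup_of_frequently_le ?_ (by isBoundedDefault)
    rw [Filter.frequently_iff]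
    exact fun hU => ⟨p, mem_of_mem_nhds hU, le_rfl⟩

lemma le_mul_add_of_inv_mul_add_le {d : ℕ} (hd : d ≠ 0) {t S : EReal} {a b : ℝ}
    (hab : -b ≤ a) (h : (((d : ℝ)⁻¹ : ℝ) : EReal) * t + (a : EReal) ≤ S) :
    t ≤ (d : ℝ) * (S + (b : ℝ)) := by
  have hd0 : (0 : ℝ) < d := by exact_mod_cast Nat.pos_of_ne_zero hd
  have hdpos : (0 : ℝ) < (d : ℝ)⁻¹ := by positivity
  induction S with
  | top =>
    rw [EReal.top_add_coe, EReal.coe_mul_top_of_pos hd0]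
    exact le_top
  | bot =>
    induction t with
    | bot => exact bot_le
    | coe r =>
      rw [← EReal.coe_mul, ← EReal.coe_add] at h
      exact absurd (le_bot_iff.1 h) (EReal.coe_ne_bot _)
    | top => simp [EReal.coe_mul_top_of_pos hdpos] at h
  | coe s =>
    induction t with
    | bot => exact bot_le
    | coe r =>
      have h : (d : ℝ)⁻¹ * r + a ≤ s := by exact_mod_cast h
      have h' : r ≤ d * (s + b) := by
        have : (d : ℝ)⁻¹ * r ≤ s + b := by linarith
        rwa [inv_mul_le_iff₀ hd0] at this
      exact_mod_cast h'
    | top => simp [EReal.coe_mul_top_of_pos hdpos] at h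

/-- The extremal function of an image under an endomorphism of degree `d`. -/
theorem IsGivenByDegree.exists_iSup_extremal_image_le {n d : ℕ} {f : CP n → CP n}
    (hf : IsGivenByDegree f d) (hcont : Continuous f) (hd : d ≠ 0) :
    ∃ D : ℝ, 0 < D ∧ ∀ K : Set (CP n),
      ⨆ p, extremal (f '' K) p ≤ (d : ℝ) * ((⨆ p, extremal K p) + (D : ℝ)) := by
  obtain ⟨C, g, hg, hpull⟩ := hf.exists_pullback hcont hd
  -- One `|C|` pushes the pullback below `0` on `K`, the other absorbs `g` when solving for `φ`; the
  -- `1` makes the constant positive.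
  refine ⟨2 * |C| + 1, by positivity, fun K => iSup_le fun y => sSup_le ?_⟩
  rintro _ ⟨φ, hφ, hφK, rfl⟩
  obtain ⟨x, rfl⟩ := hf.surjective hd y
  have hψ := hpull φ hφ (-|C|)
  have hle : (((d : ℝ)⁻¹ : ℝ) : EReal) * φ (f x) + ((g x + -|C| : ℝ) : EReal) ≤
      ⨆ p, extremal K p := by
    suffices hK : ∀ q ∈ K, (((d : ℝ)⁻¹ : ℝ) : EReal) * φ (f q) + ((g q + -|C| : ℝ) : EReal) ≤ 0 from
      le_iSup_of_le x (by unfold extremal; exact le_sSup ⟨_, hψ, hK, rfl⟩)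
    intro q hq
    have h1 : φ (f q) ≤ 0 := hφK _ (Set.mem_image_of_mem f hq)
    have h2 : g q + -|C| ≤ 0 := by
      linarith [(abs_le.1 (hg q)).2, le_abs_self C]
    have h3 : (((d : ℝ)⁻¹ : ℝ) : EReal) * φ (f q) ≤ 0 :=
      mul_nonpos_of_nonneg_of_nonpos (by exact_mod_cast (by positivity : (0 : ℝ) ≤ (d : ℝ)⁻¹)) h1
    have h4 : ((g q + -|C| : ℝ) : EReal) ≤ 0 := by exact_mod_cast h2
    exact add_nonpos h3 h4
  refine le_mul_add_of_inv_mul_add_le hd ?_ hle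
  linarith [(abs_le.1 (hg x)).1, le_abs_self C]

lemma mul_exp_pow_le {d : ℕ} (hd : d ≠ 0) {S S' : EReal} {D : ℝ}
    (h : S' ≤ (d : ℝ) * (S + (D : ℝ))) :
    (ENNReal.ofReal (Real.exp (-D)) * EReal.exp (-S)) ^ d ≤ EReal.exp (-S') := by
  have hd0 : (0 : ℝ) < d := by exact_mod_cast Nat.pos_of_ne_zero hd
  induction S with
  | top => simp [hd]
  | bot =>
    rw [EReal.bot_add, EReal.coe_mul_bot_of_pos hd0] at h
    have h1 : S' = ⊥ := le_bot_iff.1 h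
    simp [h1]
  | coe s =>
    have h1 : EReal.exp (-(((d * (s + D) : ℝ)) : EReal)) ≤ EReal.exp (-S') := by
      rw [EReal.exp_le_exp_iff, EReal.neg_le_neg_iff]
      exact_mod_cast h
    refine le_trans (le_of_eq ?_) h1
    rw [← EReal.coe_neg, ← EReal.coe_neg, EReal.exp_coe, EReal.exp_coe,
      ← ENNReal.ofReal_mul (Real.exp_pos _).le, ← Real.exp_add,
      ← ENNReal.ofReal_pow (Real.exp_pos _).le, ← Real.exp_nat_mul]
    congr 2
    ring

/-- The Alexander capacity of an image under an endomorphism of degree `d`. -/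
theorem IsGivenByDegree.exists_alexanderCapacity_image_ge {n d : ℕ} {f : CP n → CP n}
    (hf : IsGivenByDegree f d) (hcont : Continuous f) (hd : d ≠ 0) :
    ∃ β : ℝ, 0 < β ∧ β < 1 ∧ ∀ K : Set (CP n),
      (ENNReal.ofReal β * alexanderCapacity K) ^ d ≤ alexanderCapacity (f '' K) := by
  obtain ⟨D, hD, hle⟩ := hf.exists_iSup_extremal_image_le hcont hd
  refine ⟨Real.exp (-D), Real.exp_pos _, by simpa using hD, fun K => ?_⟩
  rw [alexanderCapacity, alexanderCapacity, iSup_extremalReg, iSup_extremalReg]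
  exact mul_exp_pow_le hd (hle K)

end CP

/-! ### Iteration of the one-step estimate. -/

theorem proposition6p3 {n : ℕ} (f : CP n → CP n) (hf : CP.IsHolomorphic f)
    (hdeg : 2 ≤ CP.algebraicDegree f) :
    ∃ α : ℝ, 0 < α ∧ α < 1 ∧
      ∀ K : Set (CP n), @MeasurableSet (CP n) (borel (CP n)) K → ∀ j : ℕ,
        (ENNReal.ofReal α * CP.alexanderCapacity K) ^ (CP.algebraicDegree f ^ j) ≤
          CP.alexanderCapacity (f^[j] '' K) := by
  have hgiven : CP.IsGivenByDegree f (CP.algebraicDegree f) := by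
    -- An empty set would have `sInf` equal to `0`, against degree at least `2`.
    refine Nat.sInf_mem (s := {d | CP.IsGivenByDegree f d}) (Set.nonempty_iff_ne_empty.2 fun h => ?_)
    rw [CP.algebraicDegree, h, Nat.sInf_empty] at hdeg
    omega
  set d := CP.algebraicDegree f
  obtain ⟨β, hβ0, hβ1, hstep⟩ := hgiven.exists_alexanderCapacity_image_ge hf.1 (by omega)
  -- After `j` steps the exponent of `β` is `d + ⋯ + d ^ j`, at most `2 d ^ j - 2` because `d ≥ 2`.
  -- The slack `2` is what makes the induction close: `d + d e + 2 ≤ d (e + 2)`.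
  refine ⟨β ^ 2, by positivity, pow_lt_one₀ hβ0.le hβ1 two_ne_zero, fun K _ j => ?_⟩
  have key : ∃ e : ℕ, e + 2 ≤ 2 * d ^ j ∧
      ENNReal.ofReal β ^ e * CP.alexanderCapacity K ^ (d ^ j) ≤
        CP.alexanderCapacity (f^[j] '' K) := by
    induction j with
    | zero => exact ⟨0, by simp, by simp⟩
    | succ j ih =>
      obtain ⟨e, he, hle⟩ := ih
      refine ⟨d + d * e, ?_, ?_⟩
      · calc d + d * e + 2 ≤ d * (e + 2) := by nlinarith
          _ ≤ d * (2 * d ^ j) := Nat.mul_le_mul_left d he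
          _ = 2 * d ^ (j + 1) := by ring
      · rw [Function.iterate_succ', Set.image_comp]
        refine le_trans (le_trans (le_of_eq ?_) (pow_le_pow_left' (mul_le_mul_right hle
          (ENNReal.ofReal β)) d)) (hstep _)
        rw [mul_pow, mul_pow, ← pow_mul, ← pow_mul, pow_add, pow_succ d j, mul_assoc,
          mul_comm d e]
  obtain ⟨e, he, hle⟩ := key
  refine le_trans ?_ hle
  rw [mul_pow, ENNReal.ofReal_pow hβ0.le, ← pow_mul]
  refine mul_le_mul_left (pow_le_pow_right_of_le_one' ?_ (by omega)) _
  exact ENNReal.ofReal_le_one.2 hβ1.le
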